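/- Let $A$ be a $C^*$-algebra and $X$ a (right) Hilbert $C^*$-module over $A$, with $A$-valued inner product $\langle\cdot,\cdot\rangle$ linear in the second variable. For $x,y\in X$ let $\theta_{x,y}(z)=x\langle y,z\rangle$, and let $K(X)$ be the $C^*$-algebra of "compact" operators on $X$, that is, the closed linear span of the operators $\theta_{x,y}$ in the adjointable operators on $X$. The linking algebra of $X$ is the $C^*$-algebra $$\mathcal L(X)=\left\{\begin{bmatrix}T&x\\y^*&a\end{bmatrix}: T\in K(X),\ x,y\in X,\ a\in A\right\}$$ of operators on the Hilbert $A$-module $X\oplus A$, where the displayed matrix acts by $(z,b)\mapsto (Tz+xb,\ \langle y,z\rangle+ab)$. Let $\mathcal H,\mathcal K$ be complex Hilbert spaces, $\varphi:A\to L(\mathcal H)$ a completely positive linear map, and $\Phi:X\to L(\mathcal H,\mathcal K)$ a $\varphi$-map, i.e. $\Phi(x)^*\Phi(y)=\varphi(\langle x,y\rangle)$ for all $x,y\in X$. A minimal Stinespring representation of $(\varphi,\Phi)$ is a triple $((\Pi,\pi),(W,V),(\mathcal K',\mathcal H'))$ consisting of Hilbert spaces $\mathcal K',\mathcal H'$,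 a $*$-representation $\pi:A\to L(\mathcal H')$, a $\pi$-map $\Pi:X\to L(\mathcal H',\mathcal K')$, a bounded operator $V:\mathcal H\to\mathcal H'$ and a coisometry $W:\mathcal K\to\mathcal K'$ such that $\varphi(a)=V^*\pi(a)V$ for all $a\in A$, $\Phi(x)=W^*\Pi(x)V$ for all $x\in X$, the closed linear span of $\pi(A)V\mathcal H$ is $\mathcal H'$, and the closed linear span of $\Pi(X)V\mathcal H$ is $\mathcal K'$. For a map $\phi:K(X)\to L(\mathcal K)$ write $$\begin{bmatrix}\phi&\Phi\\\Phi^*&\varphi\end{bmatrix}:\mathcal L(X)\to L(\mathcal K\oplus\mathcal H),\qquad \begin{bmatrix}T&x\\y^*&a\end{bmatrix}\mapsto\begin{bmatrix}\phi(T)&\Phi(x)\\\Phi(y)^*&\varphi(a)\end{bmatrix},$$ and similarly for other maps in place of $\phi,\Phi,\varphi$. **Proposition.** There is a unique $*$-representation $\phi_{\Phi,\varphi}:K(X)\to L(\mathcal K)$ with the following two properties. (a) The map $\widetilde\varphi_\Phi=\begin{bmatrix}\phi_{\Phi,\varphi}&\Phi\\\Phi^*&\varphi\end{bmatrix}:\mathcal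 L(X)\to L(\mathcal K\oplus\mathcal H)$ is a completely positive linear map. (b) For every minimal Stinespring representation $((\Pi,\pi),(W,V),(\mathcal K',\mathcal H'))$ of $(\varphi,\Phi)$ there is a $*$-representation $\Gamma:K(X)\to L(\mathcal K')$ such that $\Gamma(\theta_{x,y})=\Pi(x)\Pi(y)^*$ for all $x,y\in X$ and $$\widetilde\varphi_\Phi=\begin{bmatrix}\phi_{\Phi,\varphi}&\Phi\\\Phi^*&\varphi\end{bmatrix}=\begin{bmatrix}W^*&0\\0&V^*\end{bmatrix}\begin{bmatrix}\Gamma&\Pi\\\Pi^*&\pi\end{bmatrix}\begin{bmatrix}W&0\\0&V\end{bmatrix}.$$ Moreover, if $\varphi$ is contractive, i.e. $\|\varphi(a)\|\le\|a\|$ for all $a\in A$, then $\widetilde\varphi_\Phi$ is contractive. -/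

import Mathlib

set_option linter.unusedSectionVars false

open scoped CStarAlgebra RightActions

/-! ## Right Hilbert C⋆-modules

Mathlib's class `CStarModule` is stated for an action with `⟪x, a • y⟫ = a * ⟪x, y⟫`.  For right
modules, with `⟪x, y a⟫ = ⟪x, y⟫ a`, we use the class `HilbertModule` below; it is the same thing
as Mathlib's class over the opposite C⋆-algebra, see `HilbertModule.toCStarModule`.  The right
action `x a` is written `x <• a`, which is Mathlib's notation for `MulOpposite.op a • x`. -/

/-- A right (pre-)Hilbert module over the C⋆-algebra `A`, with its norm
`‖x‖ = ‖⟪x, x⟫‖ ^ (1 / 2)`.  It is a Hilbert C⋆-module if it is complete, which is the separate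
assumption `[CompleteSpace X]`. The inner product is `A`-linear in the second variable. (The laws
of a right `A`-module follow from these axioms, see `op_smul_add`, `op_smul_mul` and so on.) -/
class HilbertModule (A X : Type*) [NonUnitalCStarAlgebra A] [PartialOrder A] [AddCommGroup X]
    [Module ℂ X] [SMul Aᵐᵒᵖ X] [Norm X] extends Inner A X where
  inner_add_right (x y z : X) : inner x (y + z) = inner x y + inner x z
  inner_smul_right (c : ℂ) (x y : X) : inner x (c • y) = c • inner x y
  inner_op_smul_right (x y : X) (a : A) : inner x (y <• a) = inner x y * a
  star_inner (x y : X) : star (inner x y) = inner y x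
  inner_self_nonneg (x : X) : 0 ≤ inner x x
  inner_self_eq_zero (x : X) : inner x x = 0 → x = 0
  norm_eq_sqrt (x : X) : ‖x‖ = √‖inner x x‖

attribute [simp] HilbertModule.inner_add_right HilbertModule.inner_smul_right
  HilbertModule.inner_op_smul_right HilbertModule.star_inner

namespace HilbertModule

section Basic

variable {A X : Type*} [NonUnitalCStarAlgebra A] [PartialOrder A] [StarOrderedRing A]
  [AddCommGroup X] [Module ℂ X] [SMul Aᵐᵒᵖ X] [Norm X] [HilbertModule A X]

/-- A right Hilbert `A`-module is a Hilbert C⋆-module over `Aᵐᵒᵖ` in the sense of Mathlib. -/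
@[reducible]
def toCStarModule : CStarModule Aᵐᵒᵖ X where
  inner x y := MulOpposite.op (inner A x y)
  inner_add_right := congrArg MulOpposite.op (inner_add_right _ _ _)
  inner_self_nonneg {x} := inner_self_nonneg (A := A) x
  inner_self {x} := by
    refine ⟨fun h => inner_self_eq_zero (A := A) x (MulOpposite.op_injective h), ?_⟩
    rintro rfl
    have := inner_smul_right (A := A) 0 (0 : X) 0
    rw [zero_smul, zero_smul] at this
    exact congrArg MulOpposite.op this
  inner_op_smul_right {a x y} := congrArg MulOpposite.op (inner_op_smul_right x y a.unop)
  inner_smul_right_complex := congrArg MulOpposite.op (inner_smul_right _ _ _)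
  star_inner x y := congrArg MulOpposite.op (star_inner x y)
  norm_eq_sqrt_norm_inner_self x := norm_eq_sqrt (A := A) x

@[simp] theorem inner_zero_right (x : X) : inner A x 0 = 0 := by
  have := inner_smul_right (A := A) 0 x 0
  rwa [zero_smul, zero_smul] at this

@[simp] theorem inner_neg_right (x y : X) : inner A x (-y) = -inner A x y := by
  have := inner_smul_right (A := A) (-1) x y
  rwa [neg_one_smul, neg_one_smul] at this

@[simp] theorem inner_sub_right (x y z : X) : inner A x (y - z) = inner A x y - inner A x z := by
  rw [sub_eq_add_neg, inner_add_right, inner_neg_right, sub_eq_add_neg]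

@[simp] theorem inner_add_left (x y z : X) : inner A (x + y) z = inner A x z + inner A y z := by
  rw [← star_inner z, inner_add_right, star_add, star_inner, star_inner]

@[simp] theorem inner_sub_left (x y z : X) : inner A (x - y) z = inner A x z - inner A y z := by
  rw [← star_inner z, inner_sub_right, star_sub, star_inner, star_inner]

@[simp] theorem inner_neg_left (x y : X) : inner A (-x) y = -inner A x y := by
  rw [← star_inner y, inner_neg_right, star_neg, star_inner]

@[simp] theorem inner_zero_left (x : X) : inner A 0 x = 0 := by
  rw [← star_inner x, inner_zero_right, star_zero]

@[simp] theorem inner_smul_left (c : ℂ) (x y : X) : inner A (c • x) y = star c • inner A x y := by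
  rw [← star_inner y, inner_smul_right, star_smul, star_inner]

@[simp] theorem inner_op_smul_left (x y : X) (a : A) : inner A (x <• a) y = star a * inner A x y := by
  rw [← star_inner y, inner_op_smul_right, star_mul, star_inner]

theorem norm_sq_eq (x : X) : ‖x‖ ^ 2 = ‖inner A x x‖ := by
  rw [norm_eq_sqrt (A := A), Real.sq_sqrt (norm_nonneg _)]

/-- The Cauchy-Schwarz inequality. -/
theorem norm_inner_le (x y : X) : ‖inner A x y‖ ≤ ‖x‖ * ‖y‖ := by
  let _ : CStarModule Aᵐᵒᵖ X := toCStarModule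
  exact CStarModule.norm_inner_le (A := Aᵐᵒᵖ) X

theorem normedSpaceCore (A X : Type*) [NonUnitalCStarAlgebra A] [PartialOrder A]
    [StarOrderedRing A] [AddCommGroup X] [Module ℂ X] [SMul Aᵐᵒᵖ X] [Norm X]
    [HilbertModule A X] : NormedSpace.Core ℂ X :=
  let _ : CStarModule Aᵐᵒᵖ X := toCStarModule
  CStarModule.normedSpaceCore Aᵐᵒᵖ

theorem eq_of_inner_left {x y : X} (h : ∀ z : X, inner A z x = inner A z y) : x = y := by
  rw [← sub_eq_zero]
  exact inner_self_eq_zero (A := A) _ (by rw [inner_sub_right, h, sub_self])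

theorem op_smul_add (x y : X) (a : A) : (x + y) <• a = x <• a + y <• a :=
  eq_of_inner_left (A := A) fun z => by
    simp only [inner_op_smul_right, inner_add_right, add_mul]

theorem op_smul_add_coeff (x : X) (a b : A) : x <• (a + b) = x <• a + x <• b :=
  eq_of_inner_left (A := A) fun z => by
    simp only [inner_op_smul_right, inner_add_right, mul_add]

theorem op_smul_mul (x : X) (a b : A) : x <• (a * b) = (x <• a) <• b :=
  eq_of_inner_left (A := A) fun z => by simp only [inner_op_smul_right, mul_assoc]

theorem smul_op_smul (c : ℂ) (x : X) (a : A) : (c • x) <• a = c • (x <• a) :=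
  eq_of_inner_left (A := A) fun z => by
    simp only [inner_op_smul_right, inner_smul_right, smul_mul_assoc]

theorem op_smul_smul_coeff (c : ℂ) (x : X) (a : A) : x <• (c • a) = c • (x <• a) :=
  eq_of_inner_left (A := A) fun z => by
    simp only [inner_op_smul_right, inner_smul_right, mul_smul_comm]

theorem zero_op_smul (a : A) : (0 : X) <• a = 0 :=
  eq_of_inner_left (A := A) fun z => by
    simp only [inner_op_smul_right, inner_zero_right, zero_mul]

theorem op_smul_zero (x : X) : x <• (0 : A) = 0 :=
  eq_of_inner_left (A := A) fun z => by
    simp only [inner_op_smul_right, inner_zero_right, mul_zero]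

end Basic

variable {A X : Type*} [NonUnitalCStarAlgebra A] [PartialOrder A] [StarOrderedRing A]
  [NormedAddCommGroup X] [NormedSpace ℂ X] [SMul Aᵐᵒᵖ X] [HilbertModule A X]

theorem norm_op_smul_le (x : X) (a : A) : ‖x <• a‖ ≤ ‖x‖ * ‖a‖ := by
  refine le_of_sq_le_sq ?_ (by positivity)
  rw [norm_sq_eq (A := A), mul_pow, norm_sq_eq (A := A) x, inner_op_smul_right,
    inner_op_smul_left]
  calc ‖star a * inner A x x * a‖ ≤ ‖star a‖ * ‖inner A x x‖ * ‖a‖ :=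
        (norm_mul_le _ _).trans (by gcongr; exact norm_mul_le _ _)
    _ = ‖inner A x x‖ * ‖a‖ ^ 2 := by rw [norm_star]; ring

theorem norm_le_of_sq {x : X} {c : ℝ} (hc : 0 ≤ c) (h : ‖inner A x x‖ ≤ c ^ 2) : ‖x‖ ≤ c :=
  le_of_sq_le_sq (by rwa [norm_sq_eq (A := A)]) hc

theorem tendsto_inner {ι : Type*} {l : Filter ι} {u v : ι → X} {x y : X}
    (hu : Filter.Tendsto u l (nhds x)) (hv : Filter.Tendsto v l (nhds y)) :
    Filter.Tendsto (fun i => inner A (u i) (v i)) l (nhds (inner A x y)) := by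
  rw [tendsto_iff_norm_sub_tendsto_zero] at hu ⊢
  have hv' := tendsto_iff_norm_sub_tendsto_zero.1 hv
  refine squeeze_zero (fun _ => norm_nonneg _)
    (g := fun i => ‖u i - x‖ * ‖v i‖ + ‖x‖ * ‖v i - y‖) (fun i => ?_) ?_
  · have : inner A (u i) (v i) - inner A x y
        = inner A (u i - x) (v i) + inner A x (v i - y) := by
      rw [inner_sub_left, inner_sub_right]; abel
    rw [this]
    exact (norm_add_le _ _).trans (add_le_add (norm_inner_le _ _) (norm_inner_le _ _))
  · simpa using (hu.mul hv.norm).add (hv'.const_mul ‖x‖)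

end HilbertModule

/-! ## Adjointable and compact operators -/

section Adjointable

variable (A E : Type*) [NonUnitalCStarAlgebra A] [PartialOrder A] [StarOrderedRing A]
  [NormedAddCommGroup E] [NormedSpace ℂ E] [SMul Aᵐᵒᵖ E] [HilbertModule A E]

/-- The adjointable operators on a right Hilbert `A`-module `E`: pairs of a bounded operator and an
adjoint of it for the `A`-valued inner product. (The adjoint is determined by the operator,
see `Adjointable.toCLM_injective`.) -/
structure Adjointable where
  toCLM : E →L[ℂ] E
  adj : E →L[ℂ] E
  inner_adj : ∀ x y : E, inner A (toCLM x) y = inner A x (adj y)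

end Adjointable

namespace Adjointable

variable {A E : Type*} [NonUnitalCStarAlgebra A] [PartialOrder A] [StarOrderedRing A]
  [NormedAddCommGroup E] [NormedSpace ℂ E] [SMul Aᵐᵒᵖ E] [HilbertModule A E]

theorem inner_adj_left (T : Adjointable A E) (x y : E) :
    inner A (T.adj x) y = inner A x (T.toCLM y) := by
  rw [← HilbertModule.star_inner y, ← T.inner_adj, HilbertModule.star_inner]

theorem adj_eq {S T : Adjointable A E} (h : S.toCLM = T.toCLM) : S.adj = T.adj := by
  ext y
  refine HilbertModule.eq_of_inner_left (A := A) fun z => ?_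
  rw [← S.inner_adj, ← T.inner_adj, h]

theorem toCLM_injective : Function.Injective (toCLM : Adjointable A E → (E →L[ℂ] E)) := by
  rintro ⟨S, S', hS⟩ ⟨T, T', hT⟩ (h : S = T)
  have := adj_eq (S := ⟨S, S', hS⟩) (T := ⟨T, T', hT⟩) h
  simp only at this
  subst h this
  rfl

@[ext]
theorem ext' {S T : Adjointable A E} (h : ∀ x, S.toCLM x = T.toCLM x) : S = T :=
  toCLM_injective (ContinuousLinearMap.ext h)

instance : Zero (Adjointable A E) := ⟨⟨0, 0, by simp⟩⟩
instance : Add (Adjointable A E) :=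
  ⟨fun S T => ⟨S.toCLM + T.toCLM, S.adj + T.adj, by simp [S.inner_adj, T.inner_adj]⟩⟩
instance : Neg (Adjointable A E) := ⟨fun S => ⟨-S.toCLM, -S.adj, by simp [S.inner_adj]⟩⟩
instance : Sub (Adjointable A E) :=
  ⟨fun S T => ⟨S.toCLM - T.toCLM, S.adj - T.adj, by simp [S.inner_adj, T.inner_adj]⟩⟩
instance : SMul ℂ (Adjointable A E) :=
  ⟨fun c S => ⟨c • S.toCLM, star c • S.adj, by simp [S.inner_adj]⟩⟩
instance : SMul ℕ (Adjointable A E) :=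
  ⟨fun n S => ⟨n • S.toCLM, n • S.adj, fun x y => by
    simp only [← Nat.cast_smul_eq_nsmul ℂ]; simp [S.inner_adj]⟩⟩
instance : SMul ℤ (Adjointable A E) :=
  ⟨fun n S => ⟨n • S.toCLM, n • S.adj, fun x y => by
    simp only [← Int.cast_smul_eq_zsmul ℂ]; simp [S.inner_adj]⟩⟩
/-- The product is the composition of operators. -/
instance : Mul (Adjointable A E) :=
  ⟨fun S T => ⟨S.toCLM * T.toCLM, T.adj * S.adj, by simp [S.inner_adj, T.inner_adj]⟩⟩
/-- The involution is the adjoint. -/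
instance : Star (Adjointable A E) := ⟨fun S => ⟨S.adj, S.toCLM, S.inner_adj_left⟩⟩

@[simp] theorem toCLM_zero : (0 : Adjointable A E).toCLM = 0 := rfl
@[simp] theorem toCLM_add (S T : Adjointable A E) : (S + T).toCLM = S.toCLM + T.toCLM := rfl
@[simp] theorem toCLM_neg (S : Adjointable A E) : (-S).toCLM = -S.toCLM := rfl
@[simp] theorem toCLM_sub (S T : Adjointable A E) : (S - T).toCLM = S.toCLM - T.toCLM := rfl
@[simp] theorem toCLM_smul (c : ℂ) (S : Adjointable A E) : (c • S).toCLM = c • S.toCLM := rfl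
@[simp] theorem toCLM_mul (S T : Adjointable A E) : (S * T).toCLM = S.toCLM * T.toCLM := rfl
@[simp] theorem toCLM_star (S : Adjointable A E) : (star S).toCLM = S.adj := rfl
@[simp] theorem adj_star (S : Adjointable A E) : (star S).adj = S.toCLM := rfl

instance : NonUnitalRing (Adjointable A E) :=
  toCLM_injective.nonUnitalRing _ rfl (fun _ _ => rfl) (fun _ _ => rfl) (fun _ => rfl)
    (fun _ _ => rfl) (fun _ _ => rfl) (fun _ _ => rfl)

/-- `toCLM` as a ring homomorphism. -/
def toCLMHom : Adjointable A E →ₙ+* (E →L[ℂ] E) where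
  toFun := toCLM
  map_mul' _ _ := rfl
  map_zero' := rfl
  map_add' _ _ := rfl

/-- The norm of an adjointable operator is its operator norm. -/
noncomputable instance : NonUnitalNormedRing (Adjointable A E) :=
  NonUnitalNormedRing.induced _ _ (toCLMHom (A := A) (E := E)) toCLM_injective

theorem norm_def (S : Adjointable A E) : ‖S‖ = ‖S.toCLM‖ := rfl

theorem isometry_toCLM : Isometry (toCLM : Adjointable A E → (E →L[ℂ] E)) :=
  AddMonoidHomClass.isometry_of_norm (toCLMHom (A := A) (E := E)) fun _ => rfl

instance : Module ℂ (Adjointable A E) :=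
  toCLM_injective.module ℂ (toCLMHom (A := A) (E := E)).toAddMonoidHom fun _ _ => rfl

noncomputable instance : NormedSpace ℂ (Adjointable A E) where
  norm_smul_le c S := by rw [norm_def, toCLM_smul, norm_smul, norm_def]

instance : IsScalarTower ℂ (Adjointable A E) (Adjointable A E) :=
  ⟨fun _ _ _ => toCLM_injective (smul_mul_assoc ..)⟩

instance : SMulCommClass ℂ (Adjointable A E) (Adjointable A E) :=
  ⟨fun _ _ _ => toCLM_injective (mul_smul_comm ..).symm⟩

instance : StarRing (Adjointable A E) where
  star_involutive _ := rfl
  star_mul _ _ := rfl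
  star_add _ _ := rfl

instance : StarModule ℂ (Adjointable A E) := ⟨fun _ _ => toCLM_injective rfl⟩

theorem norm_sq_le (S : Adjointable A E) : ‖S‖ * ‖S‖ ≤ ‖star S * S‖ := by
  have key : ‖S‖ ≤ √‖star S * S‖ := by
    refine ContinuousLinearMap.opNorm_le_bound _ (Real.sqrt_nonneg _) fun x => ?_
    change ‖S.toCLM x‖ ≤ _
    refine le_of_sq_le_sq ?_ (by positivity)
    rw [mul_pow, Real.sq_sqrt (norm_nonneg _), HilbertModule.norm_sq_eq (A := A), S.inner_adj]
    calc ‖inner A x (S.adj (S.toCLM x))‖ ≤ ‖x‖ * ‖(star S * S).toCLM x‖ :=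
          HilbertModule.norm_inner_le _ _
      _ ≤ ‖x‖ * (‖star S * S‖ * ‖x‖) := by
          gcongr; exact (star S * S).toCLM.le_opNorm x
      _ = ‖star S * S‖ * ‖x‖ ^ 2 := by ring
  calc ‖S‖ * ‖S‖ ≤ √‖star S * S‖ * √‖star S * S‖ := by gcongr
    _ = ‖star S * S‖ := Real.mul_self_sqrt (norm_nonneg _)

instance : CStarRing (Adjointable A E) := ⟨norm_sq_le⟩

theorem isometry_adj : Isometry (adj : Adjointable A E → (E →L[ℂ] E)) := by
  have : (adj : Adjointable A E → (E →L[ℂ] E)) = toCLM ∘ star := rfl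
  rw [this]
  exact isometry_toCLM.comp (starₗᵢ ℂ : Adjointable A E ≃ₗᵢ⋆[ℂ] Adjointable A E).isometry

instance [CompleteSpace E] : CompleteSpace (Adjointable A E) := by
  refine Metric.complete_of_cauchySeq_tendsto fun u hu => ?_
  obtain ⟨T, hT⟩ := cauchySeq_tendsto_of_complete
    (isometry_toCLM.uniformContinuous.comp_cauchySeq hu)
  obtain ⟨T', hT'⟩ := cauchySeq_tendsto_of_complete
    (isometry_adj.uniformContinuous.comp_cauchySeq hu)
  have h (x y : E) : inner A (T x) y = inner A x (T' y) := by
    have h1 : Filter.Tendsto (fun n => (u n).toCLM x) Filter.atTop (nhds (T x)) :=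
      ((ContinuousLinearMap.apply ℂ E x).continuous.tendsto T).comp hT
    have h2 : Filter.Tendsto (fun n => (u n).adj y) Filter.atTop (nhds (T' y)) :=
      ((ContinuousLinearMap.apply ℂ E y).continuous.tendsto T').comp hT'
    have h3 := HilbertModule.tendsto_inner (A := A) h1 (tendsto_const_nhds (x := y))
    have h4 := HilbertModule.tendsto_inner (A := A) (tendsto_const_nhds (x := x)) h2
    refine tendsto_nhds_unique h3 (h4.congr fun n => ?_)
    simp [(u n).inner_adj]
  exact ⟨⟨T, T', h⟩, isometry_toCLM.isEmbedding.tendsto_nhds_iff.2 hT⟩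

/-- The adjointable operators form a C⋆-algebra. -/
noncomputable instance [CompleteSpace E] : NonUnitalCStarAlgebra (Adjointable A E) where

variable (A) in
/-- The rank one operator `θ_{x,y}`, given by `θ_{x,y}(z) = x ⟪y, z⟫`. -/
noncomputable def theta (x y : E) : Adjointable A E where
  toCLM := LinearMap.mkContinuous
    { toFun := fun z => x <• (inner A y z : A)
      map_add' := fun z w => by
        rw [HilbertModule.inner_add_right, HilbertModule.op_smul_add_coeff]
      map_smul' := fun c z => by
        rw [HilbertModule.inner_smul_right, HilbertModule.op_smul_smul_coeff]; rfl }
    (‖y‖ * ‖x‖) fun z => by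
      calc ‖x <• (inner A y z : A)‖ ≤ ‖x‖ * ‖(inner A y z : A)‖ := HilbertModule.norm_op_smul_le ..
        _ ≤ ‖x‖ * (‖y‖ * ‖z‖) := by gcongr; exact HilbertModule.norm_inner_le _ _
        _ = ‖y‖ * ‖x‖ * ‖z‖ := by ring
  adj := LinearMap.mkContinuous
    { toFun := fun z => y <• (inner A x z : A)
      map_add' := fun z w => by
        rw [HilbertModule.inner_add_right, HilbertModule.op_smul_add_coeff]
      map_smul' := fun c z => by
        rw [HilbertModule.inner_smul_right, HilbertModule.op_smul_smul_coeff]; rfl }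
    (‖x‖ * ‖y‖) fun z => by
      calc ‖y <• (inner A x z : A)‖ ≤ ‖y‖ * ‖(inner A x z : A)‖ := HilbertModule.norm_op_smul_le ..
        _ ≤ ‖y‖ * (‖x‖ * ‖z‖) := by gcongr; exact HilbertModule.norm_inner_le _ _
        _ = ‖x‖ * ‖y‖ * ‖z‖ := by ring
  inner_adj z w := by simp

@[simp] theorem theta_apply (x y z : E) : (theta A x y).toCLM z = x <• (inner A y z : A) := rfl

theorem star_theta (x y : E) : star (theta A x y) = theta A y x := toCLM_injective rfl

theorem toCLM_op_smul (T : Adjointable A E) (x : E) (a : A) :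
    T.toCLM (x <• a) = T.toCLM x <• a :=
  HilbertModule.eq_of_inner_left (A := A) fun z => by
    rw [← T.inner_adj_left, HilbertModule.inner_op_smul_right, T.inner_adj_left,
      HilbertModule.inner_op_smul_right]

theorem mul_theta (T : Adjointable A E) (x y : E) :
    T * theta A x y = theta A (T.toCLM x) y := by
  ext z; simp [toCLM_op_smul]

end Adjointable

section Compact

variable (A E : Type*) [NonUnitalCStarAlgebra A] [PartialOrder A] [StarOrderedRing A]
  [NormedAddCommGroup E] [NormedSpace ℂ E] [SMul Aᵐᵒᵖ E] [HilbertModule A E]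

/-- The linear span of the rank one operators. -/
noncomputable def finiteRankSpan : Submodule ℂ (Adjointable A E) :=
  Submodule.span ℂ (Set.range fun p : E × E => Adjointable.theta A p.1 p.2)

/-- `K(E)`: the C⋆-algebra of "compact" operators on the right Hilbert module `E`, the closed
linear span of the operators `θ_{x,y}`. -/
noncomputable def CompactOps : NonUnitalStarSubalgebra ℂ (Adjointable A E) where
  carrier := closure (finiteRankSpan A E : Set (Adjointable A E))
  zero_mem' := (finiteRankSpan A E).topologicalClosure.zero_mem
  add_mem' := (finiteRankSpan A E).topologicalClosure.add_mem
  smul_mem' c _ h := (finiteRankSpan A E).topologicalClosure.smul_mem c h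
  mul_mem' {S T} _ hT := by
    refine map_mem_closure (f := fun T => S * T) (by fun_prop) hT fun T hT => ?_
    induction hT using Submodule.span_induction with
    | mem T h =>
      obtain ⟨p, rfl⟩ := h
      simp only [Adjointable.mul_theta]
      exact Submodule.subset_span ⟨(S.toCLM p.1, p.2), rfl⟩
    | zero => simp
    | add T T' _ _ h h' => simp only [mul_add]; exact Submodule.add_mem _ h h'
    | smul c T _ h => simp only [mul_smul_comm]; exact Submodule.smul_mem _ c h
  star_mem' {T} hT := by
    refine map_mem_closure (f := fun T => star T) continuous_star hT fun T hT => ?_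
    induction hT using Submodule.span_induction with
    | mem T h =>
      obtain ⟨p, rfl⟩ := h
      simp only [Adjointable.star_theta]
      exact Submodule.subset_span ⟨(p.2, p.1), rfl⟩
    | zero => simp
    | add T T' _ _ h h' => simp only [star_add]; exact Submodule.add_mem _ h h'
    | smul c T _ h => simp only [star_smul]; exact Submodule.smul_mem _ _ h

theorem isClosed_compactOps : IsClosed (CompactOps A E : Set (Adjointable A E)) :=
  isClosed_closure

variable {E}

/-- `θ_{x,y}` as an element of `K(E)`. -/
noncomputable def compactTheta (x y : E) : CompactOps A E :=
  ⟨Adjointable.theta A x y, subset_closure (Submodule.subset_span ⟨(x, y), rfl⟩)⟩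

end Compact

/-! ## The Hilbert module `X ⊕ A` -/

/-- The right Hilbert `A`-module `X ⊕ A`, with `(x, a) b = (x b, a b)` and
`⟪(x, a), (y, b)⟫ = ⟪x, y⟫ + a⋆ b`. -/
def SumModule (A X : Type*) : Type _ := X × A

namespace SumModule

variable {A X : Type*} [NonUnitalCStarAlgebra A] [PartialOrder A] [StarOrderedRing A]
  [NormedAddCommGroup X] [NormedSpace ℂ X] [SMul Aᵐᵒᵖ X] [HilbertModule A X]

/-- The element `(x, a)` of `X ⊕ A`. -/
def pair (x : X) (a : A) : SumModule A X := (x, a)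

instance : AddCommGroup (SumModule A X) := inferInstanceAs (AddCommGroup (X × A))
noncomputable instance : Module ℂ (SumModule A X) := inferInstanceAs (Module ℂ (X × A))
instance : SMul Aᵐᵒᵖ (SumModule A X) := ⟨fun a v => pair (a • v.1) (v.2 * a.unop)⟩
noncomputable instance : Norm (SumModule A X) :=
  ⟨fun v => √‖inner A v.1 v.1 + star v.2 * v.2‖⟩

@[ext]
theorem ext {v w : SumModule A X} (h1 : v.1 = w.1) (h2 : v.2 = w.2) : v = w := Prod.ext h1 h2

@[simp] theorem pair_fst (x : X) (a : A) : (pair x a).1 = x := rfl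
@[simp] theorem pair_snd (x : X) (a : A) : (pair x a).2 = a := rfl
@[simp] theorem zero_fst : (0 : SumModule A X).1 = 0 := rfl
@[simp] theorem zero_snd : (0 : SumModule A X).2 = 0 := rfl
@[simp] theorem add_fst (v w : SumModule A X) : (v + w).1 = v.1 + w.1 := rfl
@[simp] theorem add_snd (v w : SumModule A X) : (v + w).2 = v.2 + w.2 := rfl
@[simp] theorem smul_fst (c : ℂ) (v : SumModule A X) : (c • v).1 = c • v.1 := rfl
@[simp] theorem smul_snd (c : ℂ) (v : SumModule A X) : (c • v).2 = c • v.2 := rfl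
@[simp] theorem op_smul_fst (v : SumModule A X) (a : A) : (v <• a).1 = v.1 <• a := rfl
@[simp] theorem op_smul_snd (v : SumModule A X) (a : A) : (v <• a).2 = v.2 * a := rfl

noncomputable instance : HilbertModule A (SumModule A X) where
  inner v w := inner A v.1 w.1 + star v.2 * w.2
  inner_add_right u v w := by
    simp only [add_fst, add_snd, HilbertModule.inner_add_right, mul_add]; abel
  inner_smul_right c v w := by
    simp only [smul_fst, smul_snd, HilbertModule.inner_smul_right, mul_smul_comm, smul_add]
  inner_op_smul_right v w a := by
    simp only [op_smul_fst, op_smul_snd, HilbertModule.inner_op_smul_right, add_mul, mul_assoc]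
  star_inner v w := by
    simp only [star_add, star_mul, star_star, HilbertModule.star_inner]
  inner_self_nonneg v :=
    add_nonneg (HilbertModule.inner_self_nonneg _) (star_mul_self_nonneg _)
  inner_self_eq_zero v h := by
    have h1 : (0 : A) ≤ inner A v.1 v.1 := HilbertModule.inner_self_nonneg _
    have h2 : (0 : A) ≤ star v.2 * v.2 := star_mul_self_nonneg _
    refine ext (HilbertModule.inner_self_eq_zero (A := A) _ ?_)
      (CStarRing.star_mul_self_eq_zero_iff _ |>.1 ?_)
    · exact le_antisymm ((le_add_of_nonneg_right h2).trans_eq h) h1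
    · exact le_antisymm ((le_add_of_nonneg_left h1).trans_eq h) h2
  norm_eq_sqrt _ := rfl

noncomputable instance : NormedAddCommGroup (SumModule A X) :=
  NormedAddCommGroup.ofCore (HilbertModule.normedSpaceCore A (SumModule A X))

noncomputable instance : NormedSpace ℂ (SumModule A X) :=
  NormedSpace.ofCore (HilbertModule.normedSpaceCore A (SumModule A X))

theorem inner_def (v w : SumModule A X) : inner A v w = inner A v.1 w.1 + star v.2 * w.2 := rfl

theorem norm_fst_le (v : SumModule A X) : ‖v.1‖ ≤ ‖v‖ := by
  refine HilbertModule.norm_le_of_sq (A := A) (norm_nonneg _) ?_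
  rw [HilbertModule.norm_sq_eq (A := A) v, inner_def]
  exact CStarAlgebra.norm_le_norm_of_nonneg_of_le (HilbertModule.inner_self_nonneg _)
    (le_add_of_nonneg_right (star_mul_self_nonneg _))

theorem norm_snd_le (v : SumModule A X) : ‖v.2‖ ≤ ‖v‖ := by
  refine le_of_sq_le_sq ?_ (norm_nonneg _)
  rw [HilbertModule.norm_sq_eq (A := A) v, inner_def, sq, ← CStarRing.norm_star_mul_self]
  exact CStarAlgebra.norm_le_norm_of_nonneg_of_le (star_mul_self_nonneg _)
    (le_add_of_nonneg_left (HilbertModule.inner_self_nonneg _))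

theorem norm_le_add (v : SumModule A X) : ‖v‖ ≤ ‖v.1‖ + ‖v.2‖ := by
  refine HilbertModule.norm_le_of_sq (A := A) (by positivity) ?_
  rw [inner_def]
  refine (norm_add_le _ _).trans ?_
  rw [← HilbertModule.norm_sq_eq, CStarRing.norm_star_mul_self]
  nlinarith [norm_nonneg v.1, norm_nonneg v.2]

theorem norm_pair_left (x : X) : ‖(pair x 0 : SumModule A X)‖ = ‖x‖ :=
  le_antisymm ((norm_le_add _).trans (by simp)) (norm_fst_le (pair x (0 : A)))

theorem norm_pair_right (a : A) : ‖(pair 0 a : SumModule A X)‖ = ‖a‖ :=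
  le_antisymm ((norm_le_add _).trans (by simp)) (norm_snd_le (pair (0 : X) a))

end SumModule

/-! ## The linking algebra -/

/-- The linking algebra `L(X)`: the matrices `[[T, x], [y⋆, a]]` with `T ∈ K(X)`, `x, y ∈ X` and
`a ∈ A`, acting on `X ⊕ A` by `(z, b) ↦ (T z + x b, ⟪y, z⟫ + a b)`; the operations and the norm
are those of operators on the Hilbert module `X ⊕ A`, see `Linking.toAdj`. -/
@[ext]
structure Linking (A X : Type*) [NonUnitalCStarAlgebra A] [PartialOrder A] [StarOrderedRing A]
    [NormedAddCommGroup X] [NormedSpace ℂ X] [SMul Aᵐᵒᵖ X] [HilbertModule A X] where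
  /-- the upper left corner `T` -/
  corner : CompactOps A X
  /-- the upper right corner `x` -/
  right : X
  /-- the element `y` for which `y⋆ = ⟪y, ·⟫` is the lower left corner -/
  left : X
  /-- the lower right corner `a` -/
  coeff : A

namespace Linking

open HilbertModule SumModule

variable {A X : Type*} [NonUnitalCStarAlgebra A] [PartialOrder A] [StarOrderedRing A]
  [NormedAddCommGroup X] [NormedSpace ℂ X] [SMul Aᵐᵒᵖ X] [HilbertModule A X]

theorem norm_pair_le (T : X →L[ℂ] X) (x y : X) (a : A) (v : SumModule A X) :
    ‖pair (T v.1 + x <• v.2) (inner A y v.1 + a * v.2)‖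
      ≤ (‖T‖ + ‖x‖ + ‖y‖ + ‖a‖) * ‖v‖ := by
  have h1 := SumModule.norm_fst_le v
  have h2 := SumModule.norm_snd_le v
  have h3 : ‖T v.1‖ ≤ ‖T‖ * ‖v‖ := (T.le_opNorm _).trans (by gcongr)
  have h4 : ‖x <• v.2‖ ≤ ‖x‖ * ‖v‖ := (norm_op_smul_le _ _).trans (by gcongr)
  have h5 : ‖inner A y v.1‖ ≤ ‖y‖ * ‖v‖ :=
    (HilbertModule.norm_inner_le _ _).trans (by gcongr)
  have h6 : ‖a * v.2‖ ≤ ‖a‖ * ‖v‖ := (norm_mul_le _ _).trans (by gcongr)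
  have h7 := norm_add_le (T v.1) (x <• v.2)
  have h8 := norm_add_le (inner A y v.1) (a * v.2)
  have h9 := SumModule.norm_le_add (pair (T v.1 + x <• v.2) (inner A y v.1 + a * v.2))
  simp only [pair_fst, pair_snd] at h9
  linarith

/-- The operator `(z, b) ↦ (T z + x b, ⟪y, z⟫ + a b)` on `X ⊕ A`. -/
noncomputable def toCLM (T : X →L[ℂ] X) (x y : X) (a : A) :
    SumModule A X →L[ℂ] SumModule A X :=
  LinearMap.mkContinuous
    { toFun := fun v => pair (T v.1 + x <• v.2) (inner A y v.1 + a * v.2)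
      map_add' := fun v w => by
        ext
        · simp only [pair_fst, add_fst, add_snd, map_add, op_smul_add_coeff]; abel
        · simp only [pair_snd, add_fst, add_snd, HilbertModule.inner_add_right, mul_add]; abel
      map_smul' := fun c v => by
        ext
        · simp only [pair_fst, smul_fst, smul_snd, map_smul, op_smul_smul_coeff, smul_add,
            RingHom.id_apply]
        · simp only [pair_snd, smul_fst, smul_snd, HilbertModule.inner_smul_right, mul_smul_comm,
            smul_add, RingHom.id_apply] }
    (‖T‖ + ‖x‖ + ‖y‖ + ‖a‖) (norm_pair_le T x y a)

@[simp] theorem toCLM_fst (T : X →L[ℂ] X) (x y : X) (a : A) (v : SumModule A X) :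
    (toCLM T x y a v).1 = T v.1 + x <• v.2 := rfl

@[simp] theorem toCLM_snd (T : X →L[ℂ] X) (x y : X) (a : A) (v : SumModule A X) :
    (toCLM T x y a v).2 = inner A y v.1 + a * v.2 := rfl

/-- The matrix `[[T, x], [y⋆, a]]` as an adjointable operator on `X ⊕ A`, with adjoint
`[[T⋆, y], [x⋆, a⋆]]`. -/
noncomputable def toAdj (M : Linking A X) : Adjointable A (SumModule A X) where
  toCLM := toCLM M.corner.1.toCLM M.right M.left M.coeff
  adj := toCLM M.corner.1.adj M.left M.right (star M.coeff)
  inner_adj v w := by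
    simp only [SumModule.inner_def, toCLM_fst, toCLM_snd, HilbertModule.inner_add_left,
      HilbertModule.inner_add_right, HilbertModule.inner_op_smul_left,
      HilbertModule.inner_op_smul_right, star_add, star_mul, HilbertModule.star_inner, mul_add,
      add_mul, Adjointable.inner_adj, mul_assoc]
    abel

theorem toAdj_fst (M : Linking A X) (v : SumModule A X) :
    (M.toAdj.toCLM v).1 = M.corner.1.toCLM v.1 + M.right <• v.2 := rfl

theorem toAdj_snd (M : Linking A X) (v : SumModule A X) :
    (M.toAdj.toCLM v).2 = inner A M.left v.1 + M.coeff * v.2 := rfl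

theorem eq_of_op_smul {x y : X} (h : ∀ b : A, x <• b = y <• b) : x = y := by
  have h1 (b : A) : inner A (x - y) (x - y) * b = 0 := by
    rw [← HilbertModule.inner_op_smul_right]
    have h2 : (x - y) <• b + y <• b = y <• b := by
      rw [← op_smul_add, sub_add_cancel, h]
    rw [add_eq_right.1 h2, HilbertModule.inner_zero_right]
  rw [← sub_eq_zero]
  refine HilbertModule.inner_self_eq_zero (A := A) _ ?_
  rw [← CStarRing.mul_star_self_eq_zero_iff]
  exact h1 _

theorem toAdj_injective : Function.Injective (toAdj : Linking A X → _) := by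
  intro M N h
  have h1 (v : SumModule A X) :
      M.corner.1.toCLM v.1 + M.right <• v.2 = N.corner.1.toCLM v.1 + N.right <• v.2 := by
    rw [← toAdj_fst, h, toAdj_fst]
  have h2 (v : SumModule A X) :
      inner A M.left v.1 + M.coeff * v.2 = inner A N.left v.1 + N.coeff * v.2 := by
    rw [← toAdj_snd, h, toAdj_snd]
  refine Linking.ext ?_ ?_ ?_ ?_
  · refine Subtype.ext (Adjointable.ext' fun z => ?_)
    have := h1 (pair z 0)
    simpa only [pair_fst, pair_snd, op_smul_zero, add_zero] using this
  · refine eq_of_op_smul (A := A) fun b => ?_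
    have := h1 (pair 0 b)
    simpa only [pair_fst, pair_snd, map_zero, zero_add] using this
  · refine eq_of_inner_left (A := A) fun z => ?_
    have := h2 (pair z 0)
    simp only [pair_fst, pair_snd, mul_zero, add_zero] at this
    rw [← HilbertModule.star_inner, this, HilbertModule.star_inner]
  · have key (b : A) : (M.coeff - N.coeff) * b = 0 := by
      have := h2 (pair 0 b)
      simp only [pair_fst, pair_snd, HilbertModule.inner_zero_right, zero_add] at this
      rw [sub_mul, this, sub_self]
    rw [← sub_eq_zero, ← CStarRing.mul_star_self_eq_zero_iff]
    exact key _

noncomputable instance : Zero (Linking A X) := ⟨⟨0, 0, 0, 0⟩⟩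
noncomputable instance : Add (Linking A X) :=
  ⟨fun M N => ⟨M.corner + N.corner, M.right + N.right, M.left + N.left, M.coeff + N.coeff⟩⟩
noncomputable instance : Neg (Linking A X) := ⟨fun M => ⟨-M.corner, -M.right, -M.left, -M.coeff⟩⟩
noncomputable instance : Sub (Linking A X) :=
  ⟨fun M N => ⟨M.corner - N.corner, M.right - N.right, M.left - N.left, M.coeff - N.coeff⟩⟩
noncomputable instance : SMul ℂ (Linking A X) :=
  ⟨fun c M => ⟨c • M.corner, c • M.right, star c • M.left, c • M.coeff⟩⟩
noncomputable instance : SMul ℕ (Linking A X) :=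
  ⟨fun n M => ⟨n • M.corner, n • M.right, n • M.left, n • M.coeff⟩⟩
noncomputable instance : SMul ℤ (Linking A X) :=
  ⟨fun n M => ⟨n • M.corner, n • M.right, n • M.left, n • M.coeff⟩⟩
/-- Matrix multiplication
`[[T, x], [y⋆, a]] [[T', x'], [y'⋆, a']]
  = [[T T' + θ_{x,y'}, T x' + x a'], [(T'⋆ y + y' a⋆)⋆, ⟪y, x'⟫ + a a']]`. -/
noncomputable instance : Mul (Linking A X) :=
  ⟨fun M N =>
    ⟨M.corner * N.corner + compactTheta A M.right N.left,
      M.corner.1.toCLM N.right + M.right <• N.coeff,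
      N.corner.1.adj M.left + N.left <• star M.coeff,
      inner A M.left N.right + M.coeff * N.coeff⟩⟩
/-- The involution `[[T, x], [y⋆, a]]⋆ = [[T⋆, y], [x⋆, a⋆]]`. -/
noncomputable instance : Star (Linking A X) := ⟨fun M => ⟨star M.corner, M.left, M.right, star M.coeff⟩⟩

theorem toAdj_ext {S T : Adjointable A (SumModule A X)}
    (h1 : ∀ v, (S.toCLM v).1 = (T.toCLM v).1) (h2 : ∀ v, (S.toCLM v).2 = (T.toCLM v).2) :
    S = T :=
  Adjointable.ext' fun v => SumModule.ext (h1 v) (h2 v)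

theorem toAdj_zero : (0 : Linking A X).toAdj = 0 := by
  refine toAdj_ext (fun v => ?_) fun v => ?_
  · change (0 : X) + (0 : X) <• v.2 = 0
    rw [zero_op_smul, add_zero]
  · change inner A (0 : X) v.1 + 0 * v.2 = 0
    rw [HilbertModule.inner_zero_left, zero_mul, add_zero]

theorem toAdj_add (M N : Linking A X) : (M + N).toAdj = M.toAdj + N.toAdj := by
  refine toAdj_ext (fun v => ?_) fun v => ?_
  · change (M.corner.1.toCLM v.1 + N.corner.1.toCLM v.1) + (M.right + N.right) <• v.2
      = (M.corner.1.toCLM v.1 + M.right <• v.2) + (N.corner.1.toCLM v.1 + N.right <• v.2)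
    rw [op_smul_add]; abel
  · change inner A (M.left + N.left) v.1 + (M.coeff + N.coeff) * v.2
      = (inner A M.left v.1 + M.coeff * v.2) + (inner A N.left v.1 + N.coeff * v.2)
    rw [HilbertModule.inner_add_left, add_mul]; abel

theorem toAdj_smul (c : ℂ) (M : Linking A X) : (c • M).toAdj = c • M.toAdj := by
  refine toAdj_ext (fun v => ?_) fun v => ?_
  · change c • M.corner.1.toCLM v.1 + (c • M.right) <• v.2
      = c • (M.corner.1.toCLM v.1 + M.right <• v.2)
    rw [smul_op_smul, smul_add]
  · change inner A (star c • M.left) v.1 + (c • M.coeff) * v.2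
      = c • (inner A M.left v.1 + M.coeff * v.2)
    rw [HilbertModule.inner_smul_left, star_star, smul_add, smul_mul_assoc]

theorem toAdj_mul (M N : Linking A X) : (M * N).toAdj = M.toAdj * N.toAdj := by
  refine toAdj_ext (fun v => ?_) fun v => ?_
  · change (M.corner.1.toCLM (N.corner.1.toCLM v.1) + M.right <• (inner A N.left v.1 : A))
        + (M.corner.1.toCLM N.right + M.right <• N.coeff) <• v.2
      = M.corner.1.toCLM (N.corner.1.toCLM v.1 + N.right <• v.2)
        + M.right <• (inner A N.left v.1 + N.coeff * v.2)
    rw [op_smul_add, map_add, Adjointable.toCLM_op_smul, op_smul_add_coeff, HilbertModule.op_smul_mul]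
    abel
  · change inner A (N.corner.1.adj M.left + N.left <• star M.coeff) v.1
        + (inner A M.left N.right + M.coeff * N.coeff) * v.2
      = inner A M.left (N.corner.1.toCLM v.1 + N.right <• v.2)
        + M.coeff * (inner A N.left v.1 + N.coeff * v.2)
    rw [HilbertModule.inner_add_left, HilbertModule.inner_op_smul_left,
      HilbertModule.inner_add_right, HilbertModule.inner_op_smul_right,
      Adjointable.inner_adj_left, mul_add, add_mul, star_star, mul_assoc]
    abel

theorem toAdj_star (M : Linking A X) : (star M).toAdj = star M.toAdj :=
  Adjointable.toCLM_injective rfl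

theorem neg_eq (M : Linking A X) : -M = (-1 : ℂ) • M := by
  refine Linking.ext ?_ ?_ ?_ ?_
  · exact (neg_one_smul ℂ M.corner).symm
  · exact (neg_one_smul ℂ M.right).symm
  · change -M.left = star (-1 : ℂ) • M.left
    simp
  · exact (neg_one_smul ℂ M.coeff).symm

theorem sub_eq (M N : Linking A X) : M - N = M + -N :=
  Linking.ext (sub_eq_add_neg _ _) (sub_eq_add_neg _ _) (sub_eq_add_neg _ _) (sub_eq_add_neg _ _)

theorem nsmul_eq (n : ℕ) (M : Linking A X) : n • M = (n : ℂ) • M := by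
  refine Linking.ext ?_ ?_ ?_ ?_
  · exact (Nat.cast_smul_eq_nsmul ℂ n M.corner).symm
  · exact (Nat.cast_smul_eq_nsmul ℂ n M.right).symm
  · change n • M.left = star (n : ℂ) • M.left
    rw [star_natCast, Nat.cast_smul_eq_nsmul ℂ]
  · exact (Nat.cast_smul_eq_nsmul ℂ n M.coeff).symm

theorem zsmul_eq (n : ℤ) (M : Linking A X) : n • M = (n : ℂ) • M := by
  refine Linking.ext ?_ ?_ ?_ ?_
  · exact (Int.cast_smul_eq_zsmul ℂ n M.corner).symm
  · exact (Int.cast_smul_eq_zsmul ℂ n M.right).symm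
  · change n • M.left = star (n : ℂ) • M.left
    rw [star_intCast, Int.cast_smul_eq_zsmul ℂ]
  · exact (Int.cast_smul_eq_zsmul ℂ n M.coeff).symm

theorem toAdj_neg (M : Linking A X) : (-M).toAdj = -M.toAdj := by
  rw [neg_eq, toAdj_smul, neg_one_smul]

noncomputable instance : NonUnitalRing (Linking A X) :=
  toAdj_injective.nonUnitalRing _ toAdj_zero toAdj_add toAdj_mul toAdj_neg
    (fun M N => by rw [sub_eq, toAdj_add, toAdj_neg, sub_eq_add_neg])
    (fun n M => by rw [nsmul_eq, toAdj_smul, Nat.cast_smul_eq_nsmul])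
    (fun n M => by rw [zsmul_eq, toAdj_smul, Int.cast_smul_eq_zsmul])

/-- `toAdj` as a ring homomorphism. -/
noncomputable def toAdjHom : Linking A X →ₙ+* Adjointable A (SumModule A X) where
  toFun := toAdj
  map_mul' := toAdj_mul
  map_zero' := toAdj_zero
  map_add' := toAdj_add

/-- The norm of a matrix in `L(X)` is its operator norm on `X ⊕ A`. -/
noncomputable instance : NonUnitalNormedRing (Linking A X) :=
  NonUnitalNormedRing.induced _ _ (toAdjHom (A := A) (X := X)) toAdj_injective

theorem norm_def (M : Linking A X) : ‖M‖ = ‖M.toAdj‖ := rfl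

noncomputable instance : Module ℂ (Linking A X) :=
  toAdj_injective.module ℂ (toAdjHom (A := A) (X := X)).toAddMonoidHom toAdj_smul

noncomputable instance : NormedSpace ℂ (Linking A X) where
  norm_smul_le c M := by rw [norm_def, toAdj_smul, norm_smul, norm_def]

instance : IsScalarTower ℂ (Linking A X) (Linking A X) :=
  ⟨fun c M N => toAdj_injective (by
    simp only [smul_eq_mul, toAdj_mul, toAdj_smul, smul_mul_assoc])⟩

instance : SMulCommClass ℂ (Linking A X) (Linking A X) :=
  ⟨fun c M N => toAdj_injective (by
    simp only [smul_eq_mul, toAdj_mul, toAdj_smul, mul_smul_comm])⟩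

noncomputable instance : StarRing (Linking A X) where
  star_involutive M := toAdj_injective (by rw [toAdj_star, toAdj_star, star_star])
  star_mul M N := toAdj_injective (by simp only [toAdj_star, toAdj_mul, star_mul])
  star_add M N := toAdj_injective (by simp only [toAdj_star, toAdj_add, star_add])

instance : StarModule ℂ (Linking A X) :=
  ⟨fun c M => toAdj_injective (by simp only [toAdj_star, toAdj_smul, star_smul])⟩

instance : CStarRing (Linking A X) :=
  ⟨fun M => by
    rw [norm_def, norm_def, toAdj_mul, toAdj_star]
    exact CStarRing.norm_mul_self_le _⟩

theorem norm_apply_le (M : Linking A X) (v : SumModule A X) :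
    ‖M.toAdj.toCLM v‖ ≤ ‖M‖ * ‖v‖ :=
  M.toAdj.toCLM.le_opNorm v

theorem norm_corner_le (M : Linking A X) : ‖M.corner‖ ≤ ‖M‖ := by
  refine ContinuousLinearMap.opNorm_le_bound _ (norm_nonneg M) fun z => ?_
  have h := (SumModule.norm_fst_le _).trans (M.norm_apply_le (pair z 0))
  rwa [norm_pair_left, toAdj_fst, pair_snd, op_smul_zero, add_zero, pair_fst] at h

theorem norm_left_le (M : Linking A X) : ‖M.left‖ ≤ ‖M‖ := by
  have h := (SumModule.norm_snd_le _).trans (M.norm_apply_le (pair M.left 0))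
  rw [norm_pair_left, toAdj_snd, pair_snd, pair_fst, mul_zero, add_zero,
    ← HilbertModule.norm_sq_eq, sq] at h
  rcases (norm_nonneg M.left).eq_or_lt with h0 | h0
  · rw [← h0]; exact norm_nonneg M
  · exact le_of_mul_le_mul_right h h0

theorem norm_coeff_le (M : Linking A X) : ‖M.coeff‖ ≤ ‖M‖ := by
  have h := (SumModule.norm_snd_le _).trans (M.norm_apply_le (pair 0 (star M.coeff)))
  rw [norm_pair_right, toAdj_snd, pair_snd, pair_fst, HilbertModule.inner_zero_right, zero_add,
    CStarRing.norm_self_mul_star, norm_star] at h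
  rcases (norm_nonneg M.coeff).eq_or_lt with h0 | h0
  · rw [← h0]; exact norm_nonneg M
  · exact le_of_mul_le_mul_right h h0

theorem norm_right_le (M : Linking A X) : ‖M.right‖ ≤ ‖M‖ := by
  have h := norm_left_le (star M)
  rwa [norm_star] at h

theorem norm_le_add (M : Linking A X) :
    ‖M‖ ≤ ‖M.corner‖ + ‖M.right‖ + ‖M.left‖ + ‖M.coeff‖ :=
  ContinuousLinearMap.opNorm_le_bound _ (by positivity)
    (norm_pair_le M.corner.1.toCLM M.right M.left M.coeff)

theorem exists_tendsto_of_norm_le {F : Type*} [NormedAddCommGroup F] [CompleteSpace F]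
    {u : ℕ → Linking A X} (hu : CauchySeq u) (f : Linking A X → F)
    (hf : ∀ M N, f (M - N) = f M - f N) (hn : ∀ M, ‖f M‖ ≤ ‖M‖) :
    ∃ y, Filter.Tendsto (fun n => ‖f (u n) - y‖) Filter.atTop (nhds 0) := by
  have hl : LipschitzWith 1 f := LipschitzWith.of_dist_le_mul fun M N => by
    rw [dist_eq_norm, dist_eq_norm, ← hf, NNReal.coe_one, one_mul]; exact hn _
  obtain ⟨y, hy⟩ := cauchySeq_tendsto_of_complete (hl.uniformContinuous.comp_cauchySeq hu)
  exact ⟨y, tendsto_iff_norm_sub_tendsto_zero.1 hy⟩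

instance [CompleteSpace X] : CompleteSpace (Linking A X) := by
  have : CompleteSpace (CompactOps A X) :=
    (isClosed_compactOps A X).completeSpace_coe
  refine Metric.complete_of_cauchySeq_tendsto fun u hu => ?_
  obtain ⟨T, hT⟩ := exists_tendsto_of_norm_le hu (fun M => M.corner) (fun _ _ => rfl) norm_corner_le
  obtain ⟨x, hx⟩ := exists_tendsto_of_norm_le hu (fun M => M.right) (fun _ _ => rfl) norm_right_le
  obtain ⟨y, hy⟩ := exists_tendsto_of_norm_le hu (fun M => M.left) (fun _ _ => rfl) norm_left_le
  obtain ⟨a, ha⟩ := exists_tendsto_of_norm_le hu (fun M => M.coeff) (fun _ _ => rfl) norm_coeff_le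
  refine ⟨⟨T, x, y, a⟩, tendsto_iff_norm_sub_tendsto_zero.2 ?_⟩
  refine squeeze_zero (fun _ => norm_nonneg _) (fun n => norm_le_add _) ?_
  have := (((hT.add hx).add hy).add ha)
  simp only [add_zero] at this
  exact this

/-- The linking algebra is a C⋆-algebra. -/
noncomputable instance [CompleteSpace X] : NonUnitalCStarAlgebra (Linking A X) where

/-- The linking algebra carries the usual order of a C⋆-algebra. -/
noncomputable instance [CompleteSpace X] : PartialOrder (Linking A X) :=
  CStarAlgebra.spectralOrder _

instance [CompleteSpace X] : StarOrderedRing (Linking A X) :=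
  CStarAlgebra.spectralOrderedRing _

end Linking

/-! ## `φ`-maps, Stinespring representations, block maps -/

section BlockMaps

variable {A X H K H' K' : Type*} [NonUnitalCStarAlgebra A] [PartialOrder A] [StarOrderedRing A]
  [NormedAddCommGroup X] [NormedSpace ℂ X] [SMul Aᵐᵒᵖ X] [HilbertModule A X]
  [NormedAddCommGroup H] [InnerProductSpace ℂ H] [CompleteSpace H]
  [NormedAddCommGroup K] [InnerProductSpace ℂ K] [CompleteSpace K]
  [NormedAddCommGroup H'] [InnerProductSpace ℂ H'] [CompleteSpace H']
  [NormedAddCommGroup K'] [InnerProductSpace ℂ K'] [CompleteSpace K']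

open scoped InnerProduct

/-- `Φ : X → L(H, K)` is a `φ`-map if `Φ(x)⋆ Φ(y) = φ(⟨x, y⟩)` for all `x, y`. -/
def IsPhiMap (φ : A → (H →L[ℂ] H)) (Φ : X → (H →L[ℂ] K)) : Prop :=
  ∀ x y : X, (Φ x)† ∘L Φ y = φ (inner A x y)

/-- `((Π, π), (W, V), (K', H'))` is a minimal Stinespring representation of `(φ, Φ)`. -/
structure IsMinimalStinespring (φ : A → (H →L[ℂ] H)) (Φ : X → (H →L[ℂ] K))
    (P : X → (H' →L[ℂ] K')) (π : A →⋆ₙₐ[ℂ] (H' →L[ℂ] H'))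
    (W : K →L[ℂ] K') (V : H →L[ℂ] H') : Prop where
  /-- `Π` is a `π`-map -/
  isPhiMap : IsPhiMap π P
  /-- `W` is a coisometry -/
  coisometry : W ∘L W† = ContinuousLinearMap.id ℂ K'
  dilation : ∀ a, φ a = V† ∘L π a ∘L V
  dilation_map : ∀ x, Φ x = W† ∘L P x ∘L V
  minimal : (Submodule.span ℂ {η : H' | ∃ a ξ, η = π a (V ξ)}).topologicalClosure = ⊤
  minimal_map : (Submodule.span ℂ {η : K' | ∃ x ξ, η = P x (V ξ)}).topologicalClosure = ⊤

/-- The operator `[[P, Q], [R, S]] : K ⊕ H → K' ⊕ H'` between Hilbert space direct sums. -/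
noncomputable def blockOp (P : K →L[ℂ] K') (Q : H →L[ℂ] K') (R : K →L[ℂ] H') (S : H →L[ℂ] H') :
    WithLp 2 (K × H) →L[ℂ] WithLp 2 (K' × H') :=
  (WithLp.prodContinuousLinearEquiv 2 ℂ K' H').symm.toContinuousLinearMap ∘L
    ((P.coprod Q).prod (R.coprod S)) ∘L
    (WithLp.prodContinuousLinearEquiv 2 ℂ K H).toContinuousLinearMap

theorem blockOp_apply (P : K →L[ℂ] K') (Q : H →L[ℂ] K') (R : K →L[ℂ] H') (S : H →L[ℂ] H')
    (k : K) (h : H) :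
    blockOp P Q R S (WithLp.toLp 2 (k, h)) = WithLp.toLp 2 (P k + Q h, R k + S h) := rfl

/-- The block map `[[ρ, Φ], [Φ⋆, φ]] : L(X) → L(K ⊕ H)`,
`[[T, x], [y⋆, a]] ↦ [[ρ(T), Φ(x)], [Φ(y)⋆, φ(a)]]`. -/
noncomputable def blockMap (ρ : CompactOps A X → (K →L[ℂ] K)) (Φ : X → (H →L[ℂ] K))
    (φ : A → (H →L[ℂ] H)) (M : Linking A X) : WithLp 2 (K × H) →L[ℂ] WithLp 2 (K × H) :=
  blockOp (ρ M.corner) (Φ M.right) ((Φ M.left)†) (φ M.coeff)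

/-- A function between C⋆-algebras is a completely positive linear map. -/
def IsCompletelyPositive {A₁ A₂ : Type*} [NonUnitalCStarAlgebra A₁] [PartialOrder A₁]
    [StarOrderedRing A₁] [NonUnitalCStarAlgebra A₂] [PartialOrder A₂] [StarOrderedRing A₂]
    (f : A₁ → A₂) : Prop :=
  ∃ F : A₁ →CP A₂, ∀ a, F a = f a

end BlockMaps

universe u

section Induced

variable {A X H K : Type u} [NonUnitalCStarAlgebra A] [PartialOrder A] [StarOrderedRing A]
  [NormedAddCommGroup X] [NormedSpace ℂ X] [CompleteSpace X] [SMul Aᵐᵒᵖ X] [HilbertModule A X]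
  [NormedAddCommGroup H] [InnerProductSpace ℂ H] [CompleteSpace H]
  [NormedAddCommGroup K] [InnerProductSpace ℂ K] [CompleteSpace K]

open scoped InnerProduct

/-- The `⋆`-representation `ρ` of `K(X)` is induced by `(φ, Φ)`: the block map
`[[ρ, Φ], [Φ⋆, φ]]` is completely positive on the linking algebra, and it factors as
`diag(W⋆, V⋆) [[Γ, Π], [Π⋆, π]] diag(W, V)` through every minimal Stinespring representation
`((Π, π), (W, V), (K', H'))` of `(φ, Φ)`, with a `⋆`-representation `Γ` of `K(X)` on `K'` such that
`Γ(θ_{x,y}) = Π(x) Π(y)⋆`. -/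
structure IsInducedRep (φ : A → (H →L[ℂ] H)) (Φ : X → (H →L[ℂ] K))
    (ρ : CompactOps A X →⋆ₙₐ[ℂ] (K →L[ℂ] K)) : Prop where
  completelyPositive : IsCompletelyPositive (blockMap ρ Φ φ)
  factorization (H' K' : Type u)
    [NormedAddCommGroup H'] [InnerProductSpace ℂ H'] [CompleteSpace H']
    [NormedAddCommGroup K'] [InnerProductSpace ℂ K'] [CompleteSpace K']
    (P : X → (H' →L[ℂ] K')) (π : A →⋆ₙₐ[ℂ] (H' →L[ℂ] H')) (W : K →L[ℂ] K') (V : H →L[ℂ] H') :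
    IsMinimalStinespring φ Φ P π W V →
      ∃ Γ : CompactOps A X →⋆ₙₐ[ℂ] (K' →L[ℂ] K'),
        (∀ x y : X, Γ (compactTheta A x y) = P x ∘L (P y)†) ∧
        ∀ M : Linking A X, blockMap ρ Φ φ M =
          blockOp (W†) 0 0 (V†) ∘L blockMap Γ P π M ∘L blockOp W 0 0 V

end Induced

/-!
Everything is read off from one Stinespring representation of `(φ, Φ)`.

A family of operators `Ψ x : H → K` is total if the vectors `Ψ x h` span a dense subspace. If a
C⋆-algebra acts on the index set of a total family, linearly and compatibly with adjoints, then the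
action is implemented by a ⋆-representation on `K` (`IsTotalFamily.exists_rep`). No boundedness has
to be assumed: it follows from the Cauchy-Schwarz inequality and `p² ≤ ‖p‖ p` for `p = b⋆ b`
(`norm_synth_act_le`).

Applied to the Kolmogorov decomposition of the kernel `(a, b) ↦ φ(a⋆ b)`, this gives the Stinespring
representation `π, V` of `φ` (`CompletelyPositiveMap.exists_stinespring`). An approximate unit
bounds `V`, and shows that `V` is a contraction if `φ` is. The closed span `K'` of the vectors `Φ x ξ`, the
orthogonal projection `W` onto it, and the operators `P x : π a (V h) ↦ Φ (x a) h` complete it to a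
minimal Stinespring representation of `(φ, Φ)` (`exists_isMinimalStinespring`).

Over a representation `π`, every total `π`-map `P` induces a representation `Γ` of `K(X)` with
`Γ T (P x η) = P (T x) η`, by the same lemma applied to the adjointable operators acting on `X`
(`IsPhiMap.exists_rep`), and then the block map `[[Γ, P], [P⋆, π]]` is a ⋆-representation of the
linking algebra (`IsPhiMap.exists_linking_rep`). Its compression by `diag(W, V)` is completely
positive, and it is contractive if `V` is. The upper left corner `ρ T = W⋆ Γ(T) W` of the
compression is a ⋆-representation since `W` is a coisometry. It maps `Φ x ξ` to `Φ (T x) ξ` and vanishes on the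
orthogonal complement of these vectors, so it is the same for all minimal Stinespring
representations (`IsMinimalStinespring.compression_eq`). It is the only choice because
`Γ(θ_{x,y}) = P x (P y)⋆` determines `Γ`, by continuity (`CompactOps.rep_ext`).
-/

open scoped InnerProduct InnerProductSpace

/-! ### Total families of operators -/

section TotalFamilies

variable {X H K G : Type*}
  [NormedAddCommGroup H] [InnerProductSpace ℂ H] [CompleteSpace H]
  [NormedAddCommGroup K] [InnerProductSpace ℂ K] [CompleteSpace K]
  [NormedAddCommGroup G] [InnerProductSpace ℂ G] [CompleteSpace G]

/-- A family of operators `Ψ x : H → K` is total if the vectors `Ψ x h` span a dense subspace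
of `K`. -/
def IsTotalFamily (Ψ : X → (H →L[ℂ] K)) : Prop :=
  (Submodule.span ℂ {η : K | ∃ x ξ, η = Ψ x ξ}).topologicalClosure = ⊤

/-- The linear map `∑ x ⊗ hₓ ↦ ∑ Ψ x hₓ` on finitely supported families. -/
noncomputable def synth (Ψ : X → (H →L[ℂ] K)) : (X →₀ H) →ₗ[ℂ] K :=
  Finsupp.lsum ℂ fun x => (Ψ x : H →ₗ[ℂ] K)

theorem synth_apply (Ψ : X → (H →L[ℂ] K)) (v : X →₀ H) :
    synth Ψ v = v.sum fun x h => Ψ x h := rfl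

theorem synth_single (Ψ : X → (H →L[ℂ] K)) (x : X) (h : H) :
    synth Ψ (Finsupp.single x h) = Ψ x h := by
  rw [synth_apply, Finsupp.sum_single_index (h := fun x h => Ψ x h) (map_zero (Ψ x))]

theorem inner_synth_synth (Ψ₁ : X → (H →L[ℂ] K)) (Ψ₂ : X → (H →L[ℂ] K)) (v w : X →₀ H) :
    ⟪synth Ψ₁ v, synth Ψ₂ w⟫_ℂ
      = v.sum fun x h => w.sum fun y k => ⟪h, ((Ψ₁ x)† ∘L Ψ₂ y) k⟫_ℂ := by
  simp only [synth_apply, Finsupp.sum_inner, Finsupp.inner_sum,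
    ContinuousLinearMap.comp_apply, ContinuousLinearMap.adjoint_inner_right]
  exact Finsupp.sum_comm _ _ _

theorem inner_synth_congr {Ψ₁ Ψ₂ : X → (H →L[ℂ] K)} {Ψ₃ Ψ₄ : X → (H →L[ℂ] G)}
    (h : ∀ x y, (Ψ₁ x)† ∘L Ψ₂ y = (Ψ₃ x)† ∘L Ψ₄ y) (v w : X →₀ H) :
    ⟪synth Ψ₁ v, synth Ψ₂ w⟫_ℂ = ⟪synth Ψ₃ v, synth Ψ₄ w⟫_ℂ := by
  simp only [inner_synth_synth, h]

namespace IsTotalFamily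

variable {Ψ : X → (H →L[ℂ] K)}

theorem denseRange_synth (hΨ : IsTotalFamily Ψ) : DenseRange (synth Ψ) := by
  have h : (LinearMap.range (synth Ψ)).topologicalClosure = ⊤ := by
    rw [eq_top_iff, ← (show _ = ⊤ from hΨ)]
    refine Submodule.topologicalClosure_mono (Submodule.span_le.2 ?_)
    rintro _ ⟨x, ξ, rfl⟩
    exact ⟨Finsupp.single x ξ, synth_single Ψ x ξ⟩
  exact (Submodule.dense_iff_topologicalClosure_eq_top).2 h

theorem ext_comp (hΨ : IsTotalFamily Ψ) {R S : K →L[ℂ] G} (h : ∀ x, R ∘L Ψ x = S ∘L Ψ x) :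
    R = S := by
  refine DFunLike.coe_injective (hΨ.denseRange_synth.equalizer R.continuous S.continuous ?_)
  ext v
  simp only [Function.comp_apply, synth_apply, map_finsuppSum]
  exact Finsupp.sum_congr fun x _ => DFunLike.congr_fun (h x) (v x)

theorem ext_adjoint_comp (hΨ : IsTotalFamily Ψ) {R S : G →L[ℂ] K}
    (h : ∀ x, (Ψ x)† ∘L R = (Ψ x)† ∘L S) : R = S := by
  refine ContinuousLinearMap.adjoint.injective (hΨ.ext_comp fun x => ?_)
  have := congrArg ContinuousLinearMap.adjoint (h x)
  simpa only [ContinuousLinearMap.adjoint_comp, ContinuousLinearMap.adjoint_adjoint] using this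

/-- A family dominated by a total family factors through it. -/
theorem exists_comp_eq (hΨ : IsTotalFamily Ψ) {Ψ' : X → (H →L[ℂ] G)} {C : ℝ} (hC : 0 ≤ C)
    (h : ∀ v, ‖synth Ψ' v‖ ≤ C * ‖synth Ψ v‖) :
    ∃ R : K →L[ℂ] G, (∀ x, R ∘L Ψ x = Ψ' x) ∧ ‖R‖ ≤ C := by
  refine ⟨(synth Ψ').extendOfNorm (synth Ψ), fun x => ?_,
    LinearMap.opNorm_extendOfNorm_le hΨ.denseRange_synth hC h⟩
  ext ξ
  rw [ContinuousLinearMap.comp_apply, ← synth_single Ψ,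
    LinearMap.extendOfNorm_eq hΨ.denseRange_synth ⟨C, h⟩, synth_single]

end IsTotalFamily

end TotalFamilies

theorem CStarAlgebra.exists_eq_star_mul_self {B : Type*} [NonUnitalCStarAlgebra B] [PartialOrder B]
    [StarOrderedRing B] {b : B} (hb : 0 ≤ b) : ∃ c, b = star c * c :=
  CStarAlgebra.nonneg_iff_eq_star_mul_self.1 hb

/-! ### Automatic boundedness of representations -/

section Representations

variable {B X H K : Type*} [NonUnitalCStarAlgebra B]
  [NormedAddCommGroup H] [InnerProductSpace ℂ H] [CompleteSpace H]
  [NormedAddCommGroup K] [InnerProductSpace ℂ K] [CompleteSpace K]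

/-- An action of a C⋆-algebra on the index set of `Ψ` which is linear and adjointable after
applying `Ψ` is automatically contractive: for `p = b⋆ b`, the Cauchy-Schwarz inequality gives
`‖b v‖² = ⟪v, p v⟫ ≤ ‖v‖ ‖p v‖`, while `p² ≤ ‖p‖ p` gives `‖p v‖² ≤ ‖p‖ ‖b v‖²`. -/
theorem norm_synth_act_le {Ψ : X → (H →L[ℂ] K)} (act : B → X → X)
    (h_mul : ∀ b c x, act (b * c) x = act b (act c x))
    (h_sub : ∀ b c x, Ψ (act (b - c) x) = Ψ (act b x) - Ψ (act c x))
    (h_smul : ∀ (z : ℂ) b x, Ψ (act (z • b) x) = z • Ψ (act b x))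
    (h_adj : ∀ b x y, (Ψ (act b x))† ∘L Ψ y = (Ψ x)† ∘L Ψ (act (star b) y))
    (b : B) (v : X →₀ H) :
    ‖synth (fun x => Ψ (act b x)) v‖ ≤ ‖b‖ * ‖synth Ψ v‖ := by
  let _ : PartialOrder B := CStarAlgebra.spectralOrder B
  let _ : StarOrderedRing B := CStarAlgebra.spectralOrderedRing B
  set L : B → K := fun b => synth (fun x => Ψ (act b x)) v with hL
  have key (b c : B) : ⟪L b, L c⟫_ℂ = ⟪synth Ψ v, L (star b * c)⟫_ℂ :=
    inner_synth_congr (fun x y => by rw [h_adj, h_mul]) v v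
  have L_sub (b c : B) : L (b - c) = L b - L c := by
    simp only [hL, synth_apply, h_sub, sub_apply, Finsupp.sum_sub]
  have L_smul (z : ℂ) (b : B) : L (z • b) = z • L b := by
    simp only [hL, synth_apply, h_smul, smul_apply, Finsupp.smul_sum]
  have norm_sq (b : B) : ‖L b‖ ^ 2 = (⟪synth Ψ v, L (star b * b)⟫_ℂ).re := by
    rw [← key, ← @inner_self_eq_norm_sq ℂ]; rfl
  have mono {p q : B} (hpq : p ≤ q) :
      (⟪synth Ψ v, L p⟫_ℂ).re ≤ (⟪synth Ψ v, L q⟫_ℂ).re := by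
    obtain ⟨c, hc⟩ := CStarAlgebra.exists_eq_star_mul_self (sub_nonneg.2 hpq)
    have := norm_sq c
    rw [← hc, L_sub, inner_sub_right, Complex.sub_re] at this
    nlinarith [sq_nonneg ‖L c‖]
  have h1 : ‖L b‖ ^ 2 ≤ ‖synth Ψ v‖ * ‖L (star b * b)‖ := by
    rw [norm_sq]
    exact (Complex.re_le_norm _).trans (norm_inner_le_norm _ _)
  have h2 : ‖L (star b * b)‖ ^ 2 ≤ (‖b‖ * ‖L b‖) ^ 2 := by
    have hle : star (star b * b) * (star b * b) ≤ ((‖b‖ ^ 2 : ℝ) : ℂ) • (star b * b) := by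
      have := CStarAlgebra.star_left_conjugate_le_norm_smul (a := b) (b := b * star b)
        (IsSelfAdjoint.mul_star_self b)
      rw [CStarRing.norm_self_mul_star, ← sq, ← Complex.coe_smul] at this
      simpa only [star_mul, star_star, mul_assoc] using this
    have := mono hle
    rw [← norm_sq, L_smul, inner_smul_right, Complex.re_ofReal_mul, ← norm_sq] at this
    rwa [mul_pow]
  have h3 : ‖L (star b * b)‖ ≤ ‖b‖ * ‖L b‖ := le_of_sq_le_sq h2 (by positivity)
  change ‖L b‖ ≤ _
  rcases (norm_nonneg (L b)).eq_or_lt with h0 | h0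
  · rw [← h0]; positivity
  · refine le_of_mul_le_mul_right ?_ h0
    calc ‖L b‖ * ‖L b‖ = ‖L b‖ ^ 2 := (sq _).symm
      _ ≤ ‖synth Ψ v‖ * (‖b‖ * ‖L b‖) := h1.trans (by gcongr)
      _ = ‖b‖ * ‖synth Ψ v‖ * ‖L b‖ := by ring

/-- A ⋆-compatible action of a C⋆-algebra on the index set of a total family of operators is
implemented by a ⋆-representation. -/
theorem IsTotalFamily.exists_rep {Ψ : X → (H →L[ℂ] K)} (hΨ : IsTotalFamily Ψ) (act : B → X → X)
    (h_mul : ∀ b c x, act (b * c) x = act b (act c x))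
    (h_add : ∀ b c x, Ψ (act (b + c) x) = Ψ (act b x) + Ψ (act c x))
    (h_smul : ∀ (z : ℂ) b x, Ψ (act (z • b) x) = z • Ψ (act b x))
    (h_adj : ∀ b x y, (Ψ (act b x))† ∘L Ψ y = (Ψ x)† ∘L Ψ (act (star b) y)) :
    ∃ ρ : B →⋆ₙₐ[ℂ] (K →L[ℂ] K), ∀ b x, ρ b ∘L Ψ x = Ψ (act b x) := by
  have h_sub (b c : B) (x : X) : Ψ (act (b - c) x) = Ψ (act b x) - Ψ (act c x) := by
    rw [eq_sub_iff_add_eq, ← h_add, sub_add_cancel]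
  have hex (b : B) := hΨ.exists_comp_eq (norm_nonneg b)
    (norm_synth_act_le act h_mul h_sub h_smul h_adj b)
  choose ρ hρ _ using hex
  refine ⟨{ toFun := ρ, map_smul' := ?_, map_zero' := ?_, map_add' := ?_, map_mul' := ?_,
            map_star' := ?_ }, hρ⟩
  · intro z b
    refine hΨ.ext_comp fun x => ?_
    rw [hρ, h_smul, ← hρ]; rfl
  · refine hΨ.ext_comp fun x => ?_
    rw [hρ, ← sub_self (0 : B), h_sub, sub_self, ContinuousLinearMap.zero_comp]
  · intro b c
    refine hΨ.ext_comp fun x => ?_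
    rw [hρ, h_add, ← hρ, ← hρ, ContinuousLinearMap.add_comp]
  · intro b c
    refine hΨ.ext_comp fun x => ?_
    rw [hρ, h_mul, ← hρ, ← hρ]; rfl
  · intro b
    refine hΨ.ext_comp fun x => hΨ.ext_adjoint_comp fun y => ?_
    rw [hρ, ← h_adj, ← hρ, ContinuousLinearMap.adjoint_comp]; rfl

end Representations

/-! ### Positive operator matrices and compressions of representations -/

section CompletePositivity

variable {n G G' : Type*} [Fintype n]
  [NormedAddCommGroup G] [InnerProductSpace ℂ G] [CompleteSpace G]
  [NormedAddCommGroup G'] [InnerProductSpace ℂ G'] [CompleteSpace G']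

theorem CStarMatrix.sum_apply {m ι R : Type*} [AddCommMonoid R] (s : Finset ι)
    (M : ι → CStarMatrix m m R) (i j : m) : (∑ l ∈ s, M l) i j = ∑ l ∈ s, M l i j :=
  Matrix.sum_apply i j s M

/-- The operator matrix `(Zᵢ⋆ Zⱼ)` is positive: it is the square of the row operator
`Z = (Z₁, …, Zₙ)` on the direct sum of copies of `G`, whose positive square root is an operator
matrix again. -/
theorem CStarMatrix.nonneg_adjoint_comp (Z : n → (G →L[ℂ] G')) :
    0 ≤ (CStarMatrix.ofMatrix fun i j => (Z i)† ∘L Z j : CStarMatrix n n (G →L[ℂ] G)) := by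
  classical
  let p (i : n) : PiLp 2 (fun _ : n => G) →L[ℂ] G := PiLp.proj 2 (fun _ : n => G) i
  let s (i : n) : G →L[ℂ] PiLp 2 (fun _ : n => G) := (p i)†
  have hs (i : n) (g : G) : s i g = PiLp.single 2 i g := by
    refine ext_inner_right ℂ fun v => ?_
    rw [ContinuousLinearMap.adjoint_inner_left, PiLp.inner_apply,
      Finset.sum_eq_single i (fun j _ hj => by simp [hj]) (by simp)]
    simp [p]
  let R : PiLp 2 (fun _ : n => G) →L[ℂ] G' := ∑ i, Z i ∘L p i
  have hRs (j : n) : R ∘L s j = Z j := by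
    ext g
    simp only [R, hs, ContinuousLinearMap.comp_apply, _root_.sum_apply]
    rw [Finset.sum_eq_single j (fun i _ hi => by simp [p, hi]) (by simp)]
    simp [p]
  have hR : 0 ≤ R† ∘L R := by
    rw [ContinuousLinearMap.nonneg_iff_isPositive]
    exact ContinuousLinearMap.isPositive_adjoint_comp_self R
  obtain ⟨Q, hQ⟩ := CStarAlgebra.exists_eq_star_mul_self hR
  have : (CStarMatrix.ofMatrix fun i j => (Z i)† ∘L Z j : CStarMatrix n n (G →L[ℂ] G))
      = star (CStarMatrix.ofMatrix fun i j => p i ∘L Q ∘L s j)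
        * (CStarMatrix.ofMatrix fun i j => p i ∘L Q ∘L s j) := by
    refine CStarMatrix.ext fun i j => ?_
    ext g
    refine ext_inner_left ℂ fun h => ?_
    rw [CStarMatrix.mul_apply]
    simp only [CStarMatrix.star_apply, ContinuousLinearMap.star_eq_adjoint, _root_.sum_apply,
      inner_sum]
    change ⟪h, (((Z i)†) ∘L Z j) g⟫_ℂ = ∑ l, ⟪h, ((p l ∘L Q ∘L s i)†) (p l (Q (s j g)))⟫_ℂ
    simp only [ContinuousLinearMap.adjoint_inner_right, ContinuousLinearMap.comp_apply]
    calc ⟪Z i h, Z j g⟫_ℂ = ⟪s i h, (R† ∘L R) (s j g)⟫_ℂ := by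
          rw [ContinuousLinearMap.comp_apply, ContinuousLinearMap.adjoint_inner_right, ← hRs i,
            ← hRs j]; rfl
      _ = ⟪Q (s i h), Q (s j g)⟫_ℂ := by
          rw [hQ]; exact ContinuousLinearMap.adjoint_inner_right Q _ _
      _ = ∑ l, ⟪p l (Q (s i h)), p l (Q (s j g))⟫_ℂ := PiLp.inner_apply _ _
  rw [this]
  exact star_mul_self_nonneg _

variable {B : Type*} [NonUnitalCStarAlgebra B] [PartialOrder B] [StarOrderedRing B]

/-- Compressions of ⋆-representations are completely positive: the matrix of `D⋆ Θ((N⋆ N)ᵢⱼ) D` is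
the sum over `l` of the positive matrices with entries `(Θ(Nₗᵢ) D)⋆ (Θ(Nₗⱼ) D)`. -/
theorem isCompletelyPositive_compression (Θ : B →⋆ₙₐ[ℂ] (G' →L[ℂ] G')) (D : G →L[ℂ] G') :
    IsCompletelyPositive fun b => D† ∘L Θ b ∘L D := by
  refine ⟨{ toFun := fun b => D† ∘L Θ b ∘L D, map_add' := fun b c => ?_, map_smul' := fun z b => ?_,
            map_cstarMatrix_nonneg' := fun k M hM => ?_ }, fun _ => rfl⟩
  · ext; simp
  · ext; simp
  · obtain ⟨N, rfl⟩ := CStarAlgebra.exists_eq_star_mul_self hM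
    have : (∑ l, CStarMatrix.ofMatrix fun i j => (Θ (N l i) ∘L D)† ∘L (Θ (N l j) ∘L D) :
        CStarMatrix (Fin k) (Fin k) (G →L[ℂ] G)) = (star N * N).map fun b => D† ∘L Θ b ∘L D := by
      refine CStarMatrix.ext fun i j => ?_
      have h : (∑ l, CStarMatrix.ofMatrix fun i j => (Θ (N l i) ∘L D)† ∘L (Θ (N l j) ∘L D) :
          CStarMatrix (Fin k) (Fin k) (G →L[ℂ] G)) i j
          = ∑ l, (Θ (N l i) ∘L D)† ∘L (Θ (N l j) ∘L D) := by
        rw [CStarMatrix.sum_apply]; rfl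
      rw [h, CStarMatrix.map_apply, CStarMatrix.mul_apply, map_sum]
      ext g
      simp only [sum_apply, ContinuousLinearMap.comp_apply, map_sum,
        CStarMatrix.star_apply, map_mul, map_star]
      refine Finset.sum_congr rfl fun l _ => ?_
      rw [ContinuousLinearMap.adjoint_comp]; rfl
    change 0 ≤ (star N * N).map fun b => D† ∘L Θ b ∘L D
    rw [← this]
    exact Finset.sum_nonneg fun l _ => CStarMatrix.nonneg_adjoint_comp _

end CompletePositivity

/-! ### The Kolmogorov decomposition of a completely positive map -/

section Kernel

variable {A H : Type u} [NonUnitalCStarAlgebra A] [PartialOrder A] [StarOrderedRing A]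
  [NormedAddCommGroup H] [InnerProductSpace ℂ H] [CompleteSpace H]

/-- The matrix `(aᵢ⋆ aⱼ)` is positive: it is `N⋆ N` for the matrix `N` whose only nonzero row is
`(a₁, …, aₙ)`. -/
theorem CStarMatrix.nonneg_star_mul {n : Type*} [Fintype n] (a : n → A) :
    0 ≤ (CStarMatrix.ofMatrix fun i j => star (a i) * a j : CStarMatrix n n A) := by
  classical
  rcases isEmpty_or_nonempty n with hn | ⟨⟨k⟩⟩
  · exact le_of_eq (CStarMatrix.ext fun i => isEmptyElim i)
  · have : (CStarMatrix.ofMatrix fun i j => star (a i) * a j : CStarMatrix n n A)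
        = star (CStarMatrix.ofMatrix fun i j => if i = k then a j else 0)
          * (CStarMatrix.ofMatrix fun i j => if i = k then a j else 0) := by
      refine CStarMatrix.ext fun i j => ?_
      rw [CStarMatrix.mul_apply, Finset.sum_eq_single k]
      · change _ = star (if k = k then a i else 0) * (if k = k then a j else 0)
        rw [if_pos rfl, if_pos rfl]; rfl
      · intro l _ hl
        change star (if l = k then a i else 0) * (if l = k then a j else 0) = 0
        rw [if_neg hl, if_neg hl, mul_zero]
      · simp
    rw [this]
    exact star_mul_self_nonneg _

/-- The kernel `(a, b) ↦ φ(a⋆ b)` of a completely positive map is positive semidefinite. -/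
theorem CompletelyPositiveMap.re_sum_inner_nonneg {n : Type*} [Fintype n]
    (φ : A →CP (H →L[ℂ] H)) (a : n → A) (h : n → H) :
    0 ≤ (∑ j, ∑ i, ⟪φ (star (a i) * a j) (h j), h i⟫_ℂ).re := by
  obtain ⟨Q, hQ⟩ := CStarAlgebra.exists_eq_star_mul_self
    (φ.map_cstarMatrix_nonneg _ (CStarMatrix.nonneg_star_mul a))
  have hij (i j : n) : φ (star (a i) * a j) = ∑ l, (Q l i)† ∘L Q l j := by
    have := congrFun (congrFun hQ i) j
    rw [CStarMatrix.mul_apply] at this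
    simp only [CStarMatrix.star_apply] at this
    exact this
  have : ∑ j, ∑ i, ⟪φ (star (a i) * a j) (h j), h i⟫_ℂ
      = ∑ l, ⟪∑ j, Q l j (h j), ∑ i, Q l i (h i)⟫_ℂ := by
    simp only [hij, sum_apply, sum_inner, inner_sum, ContinuousLinearMap.comp_apply,
      ContinuousLinearMap.adjoint_inner_left]
    rw [Finset.sum_comm]
    conv_rhs => rw [Finset.sum_comm]
    refine Finset.sum_congr rfl fun i _ => ?_
    rw [Finset.sum_comm]
  rw [this, Complex.re_sum]
  exact Finset.sum_nonneg fun l _ => inner_self_nonneg (𝕜 := ℂ)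

/-- The Kolmogorov decomposition of the kernel `(a, b) ↦ φ(a⋆ b)` of a completely positive map,
realised on the reproducing kernel Hilbert space of the kernel. -/
theorem CompletelyPositiveMap.exists_kolmogorov (φ : A →CP (H →L[ℂ] H)) :
    ∃ (H' : Type u) (_ : NormedAddCommGroup H') (_ : InnerProductSpace ℂ H')
      (_ : CompleteSpace H') (Ψ : A → (H →L[ℂ] H')),
      IsTotalFamily Ψ ∧ ∀ a b, (Ψ a)† ∘L Ψ b = φ (star a * b) := by
  let κ : Matrix A A (H →L[ℂ] H) := Matrix.of fun a b => φ (star a * b)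
  have hκ : κ.PosSemidef := by
    have h := (RKHS.posSemidef_tfae (K := κ)).out 0 2
    refine h.2 ⟨?_, fun v => ?_⟩
    · ext1 a b
      rw [Matrix.conjTranspose_apply]
      change star (φ (star b * a)) = φ (star a * b)
      rw [← map_star, star_mul, star_star]
    · have := φ.re_sum_inner_nonneg (fun a : v.support => (a : A)) (fun a => v a)
      have e : ∑ b : v.support, ∑ a : v.support, ⟪φ (star (a : A) * b) (v b), v a⟫_ℂ
          = ∑ b ∈ v.support, ∑ a ∈ v.support, ⟪φ (star a * b) (v b), v a⟫_ℂ := by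
        rw [← Finset.sum_coe_sort v.support
          fun b => ∑ a ∈ v.support, ⟪φ (star a * b) (v b), v a⟫_ℂ]
        exact Finset.sum_congr rfl fun b _ =>
          Finset.sum_coe_sort v.support fun a => ⟪φ (star a * b) (v b), v a⟫_ℂ
      rw [e] at this
      exact this
  have : Fact κ.PosSemidef := ⟨hκ⟩
  refine ⟨RKHS.OfKernel κ, inferInstance, inferInstance, inferInstance,
    RKHS.kerFun (RKHS.OfKernel κ), ?_, fun a b => ?_⟩
  · have := RKHS.kerFun_dense (RKHS.OfKernel κ)
    simpa only [IsTotalFamily, eq_comm] using this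
  · rw [← RKHS.kernel_apply, RKHS.OfKernel.kernel_ofKernel]; rfl

/-- The map `∑ Ψ a hₐ ↦ ∑ φ a hₐ` is bounded by `√C`: for an approximate unit `e`, the vector
`∑ φ (e a) hₐ = (Ψ e)⋆ (∑ Ψ a hₐ)` converges to `∑ φ a hₐ`, and `‖Ψ e‖² = ‖φ (e⋆ e)‖ ≤ C`. -/
theorem norm_synth_le_of_kolmogorov {H' : Type*} [NormedAddCommGroup H'] [InnerProductSpace ℂ H']
    [CompleteSpace H'] (φ : A →CP (H →L[ℂ] H)) {Ψ : A → (H →L[ℂ] H')}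
    (hΨ : ∀ a b, (Ψ a)† ∘L Ψ b = φ (star a * b)) {C : ℝ}
    (hφ : ∀ a, ‖φ a‖ ≤ C * ‖a‖) (hC : 0 ≤ C) (v : A →₀ H) :
    ‖synth φ v‖ ≤ √C * ‖synth Ψ v‖ := by
  have hle {e : A} (he : star e = e) (he1 : ‖e‖ ≤ 1) :
      ‖synth (fun a => φ (e * a)) v‖ ≤ √C * ‖synth Ψ v‖ := by
    have h1 : synth (fun a => φ (e * a)) v = ((Ψ e)†) (synth Ψ v) := by
      simp only [synth_apply, map_finsuppSum]
      refine Finsupp.sum_congr fun a _ => ?_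
      rw [← ContinuousLinearMap.comp_apply, hΨ, he]
    rw [h1]
    refine (ContinuousLinearMap.le_opNorm _ _).trans ?_
    gcongr
    rw [LinearIsometryEquiv.norm_map]
    refine Real.le_sqrt_of_sq_le ?_
    rw [sq, ← ContinuousLinearMap.norm_adjoint_comp_self, hΨ]
    calc _ ≤ C * ‖star e * e‖ := hφ _
      _ ≤ C * 1 := by
        gcongr; rw [CStarRing.norm_star_mul_self]; nlinarith [norm_nonneg e]
      _ = C := mul_one C
  have hcont : Continuous φ := map_continuous φ
  have hlim : Filter.Tendsto (fun e => synth (fun a => φ (e * a)) v)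
      (CStarAlgebra.approximateUnit A) (nhds (synth φ v)) := by
    simp only [synth_apply, Finsupp.sum]
    refine tendsto_finsetSum _ fun a _ => ?_
    exact ((ContinuousLinearMap.apply ℂ H (v a)).continuous.tendsto _).comp
      ((hcont.tendsto a).comp ((CStarAlgebra.increasingApproximateUnit A).tendsto_mul_right a))
  refine le_of_tendsto hlim.norm ?_
  filter_upwards [(CStarAlgebra.increasingApproximateUnit A).eventually_star_eq,
    (CStarAlgebra.increasingApproximateUnit A).eventually_norm] with e he he1 using hle he he1

end Kernel

/-! ### Algebraic properties of `φ`-maps -/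

section PhiMaps

variable {A X H K : Type*} [NonUnitalCStarAlgebra A] [PartialOrder A] [StarOrderedRing A]
  [NormedAddCommGroup X] [NormedSpace ℂ X] [SMul Aᵐᵒᵖ X] [HilbertModule A X]
  [NormedAddCommGroup H] [InnerProductSpace ℂ H] [CompleteSpace H]
  [NormedAddCommGroup K] [InnerProductSpace ℂ K] [CompleteSpace K]

theorem ContinuousLinearMap.eq_of_adjoint_comp_eq {S T : H →L[ℂ] K}
    (hS : S† ∘L S = S† ∘L T) (hT : T† ∘L S = T† ∘L T) : S = T := by
  have h : (S - T)† ∘L (S - T) = 0 := by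
    rw [map_sub, ContinuousLinearMap.sub_comp, ContinuousLinearMap.comp_sub,
      ContinuousLinearMap.comp_sub, hS, hT, sub_self, sub_self, sub_self]
  have := ContinuousLinearMap.norm_adjoint_comp_self (S - T)
  rw [h, norm_zero] at this
  exact sub_eq_zero.1 (norm_eq_zero.1 (mul_self_eq_zero.1 this.symm))

namespace IsPhiMap

variable {F : Type*} [FunLike F A (H →L[ℂ] H)] [LinearMapClass F ℂ A (H →L[ℂ] H)]
  {φ : F} {Φ : X → (H →L[ℂ] K)}

theorem map_add (hΦ : IsPhiMap φ Φ) (x y : X) : Φ (x + y) = Φ x + Φ y := by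
  apply ContinuousLinearMap.eq_of_adjoint_comp_eq <;>
    simp only [_root_.map_add, ContinuousLinearMap.add_comp, ContinuousLinearMap.comp_add, hΦ _ _,
      HilbertModule.inner_add_left, HilbertModule.inner_add_right]
  abel

theorem map_smul (hΦ : IsPhiMap φ Φ) (c : ℂ) (x : X) : Φ (c • x) = c • Φ x := by
  apply ContinuousLinearMap.eq_of_adjoint_comp_eq <;>
  · simp only [LinearIsometryEquiv.map_smulₛₗ, ContinuousLinearMap.smul_comp,
      ContinuousLinearMap.comp_smul, hΦ _ _, HilbertModule.inner_smul_left,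
      HilbertModule.inner_smul_right, _root_.map_smul, smul_smul, mul_comm]

theorem map_op_smul {π : A →⋆ₙₐ[ℂ] (H →L[ℂ] H)} (hΦ : IsPhiMap π Φ) (x : X) (a : A) :
    Φ (x <• a) = Φ x ∘L π a := by
  apply ContinuousLinearMap.eq_of_adjoint_comp_eq
  · rw [← ContinuousLinearMap.comp_assoc, hΦ, hΦ, HilbertModule.inner_op_smul_right, map_mul]; rfl
  · rw [ContinuousLinearMap.adjoint_comp, ContinuousLinearMap.comp_assoc,
      ContinuousLinearMap.comp_assoc, hΦ, ← ContinuousLinearMap.comp_assoc ((Φ x)†), hΦ,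
      HilbertModule.inner_op_smul_right, map_mul]; rfl

end IsPhiMap

end PhiMaps

/-! ### Orthogonal complements of ranges -/

section Total

variable {X H K G : Type*}
  [NormedAddCommGroup H] [InnerProductSpace ℂ H] [CompleteSpace H]
  [NormedAddCommGroup K] [InnerProductSpace ℂ K] [CompleteSpace K]
  [NormedAddCommGroup G] [InnerProductSpace ℂ G] [CompleteSpace G]

theorem mem_orthogonal_span_iff {Ψ : X → (H →L[ℂ] K)} {k : K} :
    k ∈ (Submodule.span ℂ {η : K | ∃ x ξ, η = Ψ x ξ})ᗮ ↔ ∀ x, ((Ψ x)†) k = 0 := by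
  refine ⟨fun h x => ext_inner_left ℂ fun ξ => ?_, fun h => ?_⟩
  · rw [ContinuousLinearMap.adjoint_inner_right, inner_zero_right]
    have hx : Ψ x ξ ∈ Submodule.span ℂ {η : K | ∃ x ξ, η = Ψ x ξ} :=
      Submodule.subset_span ⟨x, ξ, rfl⟩
    exact Submodule.inner_right_of_mem_orthogonal hx h
  · rw [Submodule.mem_orthogonal]
    intro η hη
    induction hη using Submodule.span_induction with
    | mem η hη =>
      obtain ⟨x, ξ, rfl⟩ := hη
      rw [← ContinuousLinearMap.adjoint_inner_right, h, inner_zero_right]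
    | zero => exact inner_zero_left _
    | add η η' _ _ h1 h2 => rw [inner_add_left, h1, h2, add_zero]
    | smul c η _ h1 => rw [inner_smul_left, h1, mul_zero]

theorem isTotalFamily_iff {Ψ : X → (H →L[ℂ] K)} :
    IsTotalFamily Ψ ↔ ∀ k, (∀ x, ((Ψ x)†) k = 0) → k = 0 := by
  simp only [IsTotalFamily, Submodule.topologicalClosure_eq_top_iff, Submodule.eq_bot_iff,
    mem_orthogonal_span_iff]

theorem IsTotalFamily.of_comp {Ψ : X → (H →L[ℂ] K)} {V : G →L[ℂ] H}
    (h : IsTotalFamily fun x => Ψ x ∘L V) : IsTotalFamily Ψ :=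
  isTotalFamily_iff.2 fun k hk => isTotalFamily_iff.1 h k fun x => by
    rw [ContinuousLinearMap.adjoint_comp, ContinuousLinearMap.comp_apply, hk, map_zero]

/-- An operator is determined by its values on the ranges of a family of operators and on the
orthogonal complement of these ranges. -/
theorem ContinuousLinearMap.eq_of_comp_eq_of_orthogonal {Φ : X → (H →L[ℂ] K)} {R S : K →L[ℂ] G}
    (h : ∀ x, R ∘L Φ x = S ∘L Φ x) (h0 : ∀ k, (∀ x, ((Φ x)†) k = 0) → R k = S k) : R = S := by
  set N : Submodule ℂ K := (Submodule.span ℂ {η : K | ∃ x ξ, η = Φ x ξ}).topologicalClosure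
    with hN
  let E : Submodule ℂ K := LinearMap.ker ((R - S : K →L[ℂ] G) : K →ₗ[ℂ] G)
  have h1 : N ≤ E := by
    refine Submodule.topologicalClosure_minimal _ (Submodule.span_le.2 ?_)
      (ContinuousLinearMap.isClosed_ker (R - S))
    rintro _ ⟨x, ξ, rfl⟩
    exact sub_eq_zero.2 (DFunLike.congr_fun (h x) ξ)
  have h2 : Nᗮ ≤ E := fun k hk => by
    rw [hN, Submodule.orthogonal_closure] at hk
    exact sub_eq_zero.2 (h0 k (mem_orthogonal_span_iff.1 hk))
  have : CompleteSpace N := (Submodule.isClosed_topologicalClosure _).completeSpace_coe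
  ext k
  have hk : k ∈ N ⊔ Nᗮ := by
    rw [Submodule.sup_orthogonal_of_hasOrthogonalProjection]; trivial
  exact sub_eq_zero.1 (sup_le h1 h2 hk)

end Total

/-! ### Existence of minimal Stinespring representations -/

section Stinespring

variable {A X H K : Type u} [NonUnitalCStarAlgebra A] [PartialOrder A] [StarOrderedRing A]
  [NormedAddCommGroup X] [NormedSpace ℂ X] [SMul Aᵐᵒᵖ X] [HilbertModule A X]
  [NormedAddCommGroup H] [InnerProductSpace ℂ H] [CompleteSpace H]
  [NormedAddCommGroup K] [InnerProductSpace ℂ K] [CompleteSpace K]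

/-- The Stinespring representation of a completely positive map: the Hilbert space `H'` is spanned
by the vectors `π a (V h)`, and `V` is a contraction if `φ` is contractive. -/
theorem CompletelyPositiveMap.exists_stinespring (φ : A →CP (H →L[ℂ] H)) :
    ∃ (H' : Type u) (_ : NormedAddCommGroup H') (_ : InnerProductSpace ℂ H')
      (_ : CompleteSpace H') (π : A →⋆ₙₐ[ℂ] (H' →L[ℂ] H')) (V : H →L[ℂ] H'),
      (∀ a, φ a = V† ∘L π a ∘L V) ∧ (IsTotalFamily fun a => π a ∘L V) ∧
        ((∀ a, ‖φ a‖ ≤ ‖a‖) → ‖V‖ ≤ 1) := by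
  obtain ⟨H', _, _, _, Ψ, hΨ, hφ⟩ := φ.exists_kolmogorov
  have Ψ_add (a b : A) : Ψ (a + b) = Ψ a + Ψ b := by
    refine hΨ.ext_adjoint_comp fun c => ?_
    rw [hφ, ContinuousLinearMap.comp_add, hφ, hφ, mul_add, map_add]
  have Ψ_smul (z : ℂ) (a : A) : Ψ (z • a) = z • Ψ a := by
    refine hΨ.ext_adjoint_comp fun c => ?_
    rw [hφ, ContinuousLinearMap.comp_smul, hφ, mul_smul_comm, map_smul]
  obtain ⟨π, hπ⟩ := hΨ.exists_rep (B := A) (fun b a => b * a) (fun b c a => mul_assoc b c a)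
    (fun b c a => by rw [add_mul, Ψ_add]) (fun z b a => by rw [smul_mul_assoc, Ψ_smul])
    (fun b a c => by rw [hφ, hφ, star_mul, mul_assoc])
  -- the bound on `V` below is `√C`, so a contractive `φ` calls for `C = 1`
  obtain ⟨C, hC, hφC, hC1⟩ : ∃ C : ℝ, 0 ≤ C ∧ (∀ a, ‖φ a‖ ≤ C * ‖a‖) ∧
      ((∀ a, ‖φ a‖ ≤ ‖a‖) → √C ≤ 1) := by
    by_cases h : ∀ a, ‖φ a‖ ≤ ‖a‖
    · exact ⟨1, zero_le_one, fun a => by rw [one_mul]; exact h a, by simp⟩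
    · obtain ⟨C, hC⟩ := PositiveLinearMap.exists_norm_apply_le (.ofClass φ)
      exact ⟨C, C.2, hC, fun h' => absurd h' h⟩
  obtain ⟨R, hR, hRn⟩ := hΨ.exists_comp_eq (Real.sqrt_nonneg C)
    (norm_synth_le_of_kolmogorov φ hφ hφC hC)
  -- `V = R⋆` plays the role of the operator `h ↦ Ψ 1 h`, which is defined only for unital `A`
  have hπR (a : A) : π a ∘L R† = Ψ a := by
    refine hΨ.ext_adjoint_comp fun b => ?_
    have : (Ψ b)† ∘L π a = (Ψ (star a * b))† := by
      rw [← hπ, ContinuousLinearMap.adjoint_comp, map_star, ContinuousLinearMap.star_eq_adjoint,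
        ContinuousLinearMap.adjoint_adjoint]
    rw [← ContinuousLinearMap.comp_assoc, this, ← ContinuousLinearMap.adjoint_comp, hR, hφ,
      ← ContinuousLinearMap.star_eq_adjoint, ← map_star, star_mul, star_star]
  refine ⟨H', _, _, _, π, R†, fun a => ?_, ?_, fun h => ?_⟩
  · rw [hπR, ContinuousLinearMap.adjoint_adjoint, hR]
  · simpa only [hπR] using hΨ
  · rw [LinearIsometryEquiv.norm_map]
    exact hRn.trans (hC1 h)

/-- A pair `(φ, Φ)` has a minimal Stinespring representation: on the Stinespring space of `φ`, take
`P x (π a (V h)) = W (Φ (x a) h)`, where `W` is the orthogonal projection onto the closed span of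
the vectors `Φ x ξ`. -/
theorem exists_isMinimalStinespring (φ : A →CP (H →L[ℂ] H)) (Φ : X → (H →L[ℂ] K))
    (hΦ : IsPhiMap φ Φ) :
    ∃ (H' : Type u) (_ : NormedAddCommGroup H') (_ : InnerProductSpace ℂ H')
      (_ : CompleteSpace H') (K' : Type u) (_ : NormedAddCommGroup K')
      (_ : InnerProductSpace ℂ K') (_ : CompleteSpace K')
      (P : X → (H' →L[ℂ] K')) (π : A →⋆ₙₐ[ℂ] (H' →L[ℂ] H')) (W : K →L[ℂ] K') (V : H →L[ℂ] H'),
      IsMinimalStinespring φ Φ P π W V ∧ ((∀ a, ‖φ a‖ ≤ ‖a‖) → ‖V‖ ≤ 1) := by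
  obtain ⟨H', _, _, _, π, V, hV, hπV, hV1⟩ := φ.exists_stinespring
  let K' : Submodule ℂ K := (Submodule.span ℂ {η : K | ∃ x ξ, η = Φ x ξ}).topologicalClosure
  have : CompleteSpace K' := (Submodule.isClosed_topologicalClosure _).completeSpace_coe
  let W : K →L[ℂ] K' := K'.orthogonalProjectionOnto
  have hW : W† = K'.subtypeL := K'.adjoint_orthogonalProjectionOnto
  have hWW : W ∘L W† = ContinuousLinearMap.id ℂ K' := by
    ext1 k
    rw [hW]; exact K'.orthogonalProjectionOnto_mem_subspace_eq_self k
  have hWΦ (x : X) : W† ∘L W ∘L Φ x = Φ x := by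
    ext ξ
    rw [hW]
    exact Submodule.starProjection_eq_self_iff.2
      (Submodule.le_topologicalClosure _ (Submodule.subset_span ⟨x, ξ, rfl⟩))
  have hWΦ' (x y : X) : (W ∘L Φ x)† ∘L (W ∘L Φ y) = φ (inner A x y) := by
    rw [ContinuousLinearMap.adjoint_comp, ContinuousLinearMap.comp_assoc, hWΦ, hΦ]
  have hWtot : IsTotalFamily fun x => W ∘L Φ x := by
    refine isTotalFamily_iff.2 fun k hk => ?_
    have h1 : (k : K) ∈ K'ᗮ := by
      rw [Submodule.orthogonal_closure, mem_orthogonal_span_iff]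
      intro x
      have := hk x
      rwa [ContinuousLinearMap.adjoint_comp, hW] at this
    exact Subtype.ext (inner_self_eq_zero.1 (Submodule.inner_right_of_mem_orthogonal k.2 h1))
  have hππ (a b c : A) : (π a ∘L V)† ∘L (π b ∘L π c ∘L V) = φ (star a * b * c) := by
    rw [hV, mul_assoc, map_mul, map_mul, map_star, ContinuousLinearMap.adjoint_comp]; rfl
  have hbound (x : X) (v : A →₀ H) :
      ‖synth (fun a => W ∘L Φ (x <• a)) v‖ ≤ ‖x‖ * ‖synth (fun a => π a ∘L V) v‖ := by
    refine le_of_sq_le_sq ?_ (by positivity)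
    set η := synth (fun a => π a ∘L V) v
    have h1 : synth (fun a => π (inner A x x) ∘L π a ∘L V) v = π (inner A x x) η := by
      simp only [η, synth_apply, map_finsuppSum]; rfl
    have h2 : ⟪synth (fun a => W ∘L Φ (x <• a)) v, synth (fun a => W ∘L Φ (x <• a)) v⟫_ℂ
        = ⟪η, π (inner A x x) η⟫_ℂ := by
      rw [← h1]
      refine inner_synth_congr (fun a b => ?_) v v
      rw [hWΦ', hππ, HilbertModule.inner_op_smul_left, HilbertModule.inner_op_smul_right, mul_assoc]
    rw [← @inner_self_eq_norm_sq ℂ, h2, mul_pow, HilbertModule.norm_sq_eq (A := A)]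
    calc (⟪η, π (inner A x x) η⟫_ℂ).re ≤ ‖η‖ * ‖π (inner A x x) η‖ :=
          (Complex.re_le_norm _).trans (norm_inner_le_norm _ _)
      _ ≤ ‖η‖ * (‖inner A x x‖ * ‖η‖) := by
          gcongr
          refine (ContinuousLinearMap.le_opNorm _ _).trans ?_
          gcongr
          exact NonUnitalStarAlgHom.norm_apply_le π _
      _ = ‖inner A x x‖ * ‖η‖ ^ 2 := by ring
  choose P hP _ using fun x => hπV.exists_comp_eq (norm_nonneg x) (hbound x)
  -- `V h` need not be of the form `π a (V k)`, so `P x ∘ V` is computed by duality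
  have hPV (x : X) : P x ∘L V = W ∘L Φ x := by
    refine hWtot.ext_adjoint_comp fun y => ?_
    have : (P x)† ∘L (W ∘L Φ y) = π (inner A x y) ∘L V := by
      refine hπV.ext_adjoint_comp fun a => ?_
      rw [← ContinuousLinearMap.comp_assoc, ← ContinuousLinearMap.adjoint_comp, hP, hWΦ',
        ContinuousLinearMap.adjoint_comp, HilbertModule.inner_op_smul_left, hV, map_mul, map_star]
      rfl
    rw [hWΦ', ← ContinuousLinearMap.comp_assoc]
    have h2 := congrArg ContinuousLinearMap.adjoint this
    rw [ContinuousLinearMap.adjoint_comp, ContinuousLinearMap.adjoint_adjoint] at h2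
    rw [h2, ContinuousLinearMap.adjoint_comp, ← ContinuousLinearMap.star_eq_adjoint, ← map_star,
      HilbertModule.star_inner, hV]; rfl
  refine ⟨H', _, _, _, K', _, _, inferInstance, P, π, W, V, ⟨?_, hWW, hV, ?_, hπV, ?_⟩, hV1⟩
  · intro x y
    refine hπV.ext_comp fun b => hπV.ext_adjoint_comp fun a => ?_
    rw [ContinuousLinearMap.comp_assoc, hP, ← ContinuousLinearMap.comp_assoc,
      ← ContinuousLinearMap.adjoint_comp, hP, hWΦ']
    refine Eq.trans ?_ (hππ a (inner A x y) b).symm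
    simp only [HilbertModule.inner_op_smul_left, HilbertModule.inner_op_smul_right, mul_assoc]
  · intro x
    rw [hPV, hWΦ]
  · have : (fun x => P x ∘L V) = fun x => W ∘L Φ x := funext hPV
    change IsTotalFamily fun x => P x ∘L V
    rwa [this]

end Stinespring

/-! ### Block operators -/

section BlockOperators

variable {H K H' K' H'' K'' : Type*}
  [NormedAddCommGroup H] [InnerProductSpace ℂ H] [CompleteSpace H]
  [NormedAddCommGroup K] [InnerProductSpace ℂ K] [CompleteSpace K]
  [NormedAddCommGroup H'] [InnerProductSpace ℂ H'] [CompleteSpace H']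
  [NormedAddCommGroup K'] [InnerProductSpace ℂ K'] [CompleteSpace K']
  [NormedAddCommGroup H''] [InnerProductSpace ℂ H''] [CompleteSpace H'']
  [NormedAddCommGroup K''] [InnerProductSpace ℂ K''] [CompleteSpace K'']

theorem blockOp_ext {S T : WithLp 2 (K × H) →L[ℂ] WithLp 2 (K' × H')}
    (h : ∀ k h, S (WithLp.toLp 2 (k, h)) = T (WithLp.toLp 2 (k, h))) : S = T := by
  ext1 v
  exact h v.fst v.snd

theorem blockOp_comp (P' : K' →L[ℂ] K'') (Q' : H' →L[ℂ] K'') (R' : K' →L[ℂ] H'')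
    (S' : H' →L[ℂ] H'') (P : K →L[ℂ] K') (Q : H →L[ℂ] K') (R : K →L[ℂ] H') (S : H →L[ℂ] H') :
    blockOp P' Q' R' S' ∘L blockOp P Q R S
      = blockOp (P' ∘L P + Q' ∘L R) (P' ∘L Q + Q' ∘L S) (R' ∘L P + S' ∘L R)
          (R' ∘L Q + S' ∘L S) := by
  refine blockOp_ext fun k h => ?_
  simp only [ContinuousLinearMap.comp_apply, blockOp_apply, map_add, add_apply]
  congr 2 <;> abel

theorem adjoint_blockOp (P : K →L[ℂ] K') (Q : H →L[ℂ] K') (R : K →L[ℂ] H') (S : H →L[ℂ] H') :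
    (blockOp P Q R S)† = blockOp (P†) (R†) (Q†) (S†) := by
  refine Eq.symm ((ContinuousLinearMap.eq_adjoint_iff _ _).2 fun v w => ?_)
  obtain ⟨k, h⟩ := w
  obtain ⟨k', h'⟩ := v
  simp only [blockOp_apply, WithLp.prod_inner_apply, inner_add_left, inner_add_right,
    ContinuousLinearMap.adjoint_inner_left]
  ring

theorem blockOp_add (P P' : K →L[ℂ] K') (Q Q' : H →L[ℂ] K') (R R' : K →L[ℂ] H')
    (S S' : H →L[ℂ] H') :
    blockOp (P + P') (Q + Q') (R + R') (S + S') = blockOp P Q R S + blockOp P' Q' R' S' := by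
  refine blockOp_ext fun k h => ?_
  simp only [blockOp_apply, add_apply, ← WithLp.toLp_add, Prod.mk_add_mk]
  congr 2 <;> abel

theorem blockOp_smul (c : ℂ) (P : K →L[ℂ] K') (Q : H →L[ℂ] K') (R : K →L[ℂ] H')
    (S : H →L[ℂ] H') :
    blockOp (c • P) (c • Q) (c • R) (c • S) = c • blockOp P Q R S := by
  refine blockOp_ext fun k h => ?_
  simp only [blockOp_apply, smul_apply, ← WithLp.toLp_smul, Prod.smul_mk, smul_add]

theorem norm_blockOp_diag_le {W : K →L[ℂ] K'} {V : H →L[ℂ] H'} (hW : ‖W‖ ≤ 1) (hV : ‖V‖ ≤ 1) :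
    ‖blockOp W 0 0 V‖ ≤ 1 := by
  refine ContinuousLinearMap.opNorm_le_bound _ zero_le_one fun v => ?_
  obtain ⟨k, h⟩ := v
  rw [one_mul, blockOp_apply]
  refine le_of_sq_le_sq ?_ (norm_nonneg _)
  simp only [WithLp.prod_norm_sq_eq_of_L2, zero_apply, add_zero, zero_add]
  have h1 : ‖W k‖ ≤ ‖k‖ := (W.le_of_opNorm_le hW k).trans_eq (one_mul _)
  have h2 : ‖V h‖ ≤ ‖h‖ := (V.le_of_opNorm_le hV h).trans_eq (one_mul _)
  change ‖W k‖ ^ 2 + ‖V h‖ ^ 2 ≤ ‖k‖ ^ 2 + ‖h‖ ^ 2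
  gcongr

end BlockOperators

/-! ### Representations of the compact operators and of the linking algebra -/

section Linking

variable {A X H K H' K' : Type*} [NonUnitalCStarAlgebra A] [PartialOrder A] [StarOrderedRing A]
  [NormedAddCommGroup X] [NormedSpace ℂ X] [CompleteSpace X] [SMul Aᵐᵒᵖ X] [HilbertModule A X]
  [NormedAddCommGroup H] [InnerProductSpace ℂ H] [CompleteSpace H]
  [NormedAddCommGroup K] [InnerProductSpace ℂ K] [CompleteSpace K]
  [NormedAddCommGroup H'] [InnerProductSpace ℂ H'] [CompleteSpace H']
  [NormedAddCommGroup K'] [InnerProductSpace ℂ K'] [CompleteSpace K']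

/-- The representation of the compact operators induced by a map `P` of Hilbert modules over a
representation `π` of the coefficient algebra. -/
theorem IsPhiMap.exists_rep {π : A →⋆ₙₐ[ℂ] (H' →L[ℂ] H')} {P : X → (H' →L[ℂ] K')}
    (hP : IsPhiMap π P) (htot : IsTotalFamily P) :
    ∃ Γ : CompactOps A X →⋆ₙₐ[ℂ] (K' →L[ℂ] K'),
      (∀ x y, Γ (compactTheta A x y) = P x ∘L (P y)†) ∧
        ∀ (T : CompactOps A X) x, Γ T ∘L P x = P (T.1.toCLM x) := by
  obtain ⟨Γ, hΓ⟩ := htot.exists_rep (B := Adjointable A X) (fun T x => T.toCLM x)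
    (fun _ _ _ => rfl) (fun S T x => hP.map_add _ _) (fun c T x => hP.map_smul _ _)
    (fun T x y => by rw [hP, hP, T.inner_adj]; rfl)
  refine ⟨Γ.comp (NonUnitalStarSubalgebraClass.subtype (CompactOps A X)), fun x y => ?_,
    fun T x => hΓ T.1 x⟩
  refine htot.ext_comp fun z => ?_
  rw [ContinuousLinearMap.comp_assoc, hP, ← hP.map_op_smul]
  exact hΓ _ z

/-- Over a representation `π`, the block map of a `π`-map and the representation of the compact
operators that it induces is multiplicative. -/
theorem IsPhiMap.exists_linking_rep {π : A →⋆ₙₐ[ℂ] (H' →L[ℂ] H')} {P : X → (H' →L[ℂ] K')}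
    (hP : IsPhiMap π P) {Γ : CompactOps A X →⋆ₙₐ[ℂ] (K' →L[ℂ] K')}
    (hθ : ∀ x y, Γ (compactTheta A x y) = P x ∘L (P y)†)
    (hΓ : ∀ (T : CompactOps A X) x, Γ T ∘L P x = P (T.1.toCLM x)) :
    ∃ Θ : Linking A X →⋆ₙₐ[ℂ] (WithLp 2 (K' × H') →L[ℂ] WithLp 2 (K' × H')),
      ∀ M, Θ M = blockMap Γ P π M := by
  have hsmul (c : ℂ) (M : Linking A X) : blockMap Γ P π (c • M) = c • blockMap Γ P π M := by
    refine Eq.trans ?_ (blockOp_smul c _ _ _ _)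
    change blockOp (Γ (c • M.corner)) (P (c • M.right)) ((P (star c • M.left))†)
      (π (c • M.coeff)) = _
    rw [_root_.map_smul Γ, _root_.map_smul π, hP.map_smul, hP.map_smul,
      LinearIsometryEquiv.map_smulₛₗ]
    simp
  refine ⟨{ toFun := blockMap Γ P π, map_smul' := hsmul, map_zero' := ?_, map_add' := ?_,
            map_mul' := ?_, map_star' := ?_ }, fun _ => rfl⟩
  · have := hsmul 0 0
    rw [zero_smul] at this
    exact this.trans (zero_smul ℂ (blockMap Γ P π (0 : Linking A X)))
  · intro M N
    refine Eq.trans ?_ (blockOp_add _ _ _ _ _ _ _ _)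
    change blockOp (Γ (M.corner + N.corner)) (P (M.right + N.right)) ((P (M.left + N.left))†)
      (π (M.coeff + N.coeff)) = _
    rw [_root_.map_add Γ, _root_.map_add π, hP.map_add, hP.map_add, _root_.map_add]
  · intro M N
    refine Eq.trans ?_ (blockOp_comp _ _ _ _ _ _ _ _).symm
    change blockOp (Γ (M.corner * N.corner + compactTheta A M.right N.left))
      (P (M.corner.1.toCLM N.right + M.right <• N.coeff))
      ((P (N.corner.1.adj M.left + N.left <• star M.coeff))†)
      (π (inner A M.left N.right + M.coeff * N.coeff)) = _
    have h1 : (P (N.corner.1.adj M.left))† = (P M.left)† ∘L Γ N.corner := by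
      have := hΓ (star N.corner) M.left
      rw [map_star, ContinuousLinearMap.star_eq_adjoint] at this
      refine Eq.trans (congrArg _ this.symm) ?_
      rw [ContinuousLinearMap.adjoint_comp, ContinuousLinearMap.adjoint_adjoint]
    have h2 : (P (N.left <• star M.coeff))† = π M.coeff ∘L (P N.left)† := by
      rw [hP.map_op_smul, ContinuousLinearMap.adjoint_comp, map_star,
        ContinuousLinearMap.star_eq_adjoint, ContinuousLinearMap.adjoint_adjoint]
    rw [_root_.map_add Γ, map_mul Γ, hθ, hP.map_add, ← hΓ, hP.map_op_smul, hP.map_add,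
      _root_.map_add ContinuousLinearMap.adjoint, h1, h2, _root_.map_add π, map_mul π,
      ← hP M.left N.right]
    rfl
  · intro M
    refine Eq.trans ?_ (adjoint_blockOp _ _ _ _).symm
    change blockOp (Γ (star M.corner)) (P M.left) ((P M.right)†) (π (star M.coeff)) = _
    rw [map_star, map_star, ContinuousLinearMap.adjoint_adjoint]
    rfl

/-- A representation of the compact operators is determined by its values on the rank one
operators. -/
theorem CompactOps.rep_ext {Γ Γ' : CompactOps A X →⋆ₙₐ[ℂ] (K →L[ℂ] K)}
    (h : ∀ x y, Γ (compactTheta A x y) = Γ' (compactTheta A x y)) : Γ = Γ' := by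
  have hclosed : IsClosed (CompactOps A X : Set (Adjointable A X)) := isClosed_compactOps A X
  have hc (Γ : CompactOps A X →⋆ₙₐ[ℂ] (K →L[ℂ] K)) : Continuous Γ :=
    map_continuous Γ
  have hspan (T : Adjointable A X) (hT : T ∈ finiteRankSpan A X) :
      Γ ⟨T, subset_closure hT⟩ = Γ' ⟨T, subset_closure hT⟩ := by
    induction hT using Submodule.span_induction with
    | mem T hT => obtain ⟨p, rfl⟩ := hT; exact h p.1 p.2
    | zero => exact (map_zero Γ).trans (map_zero Γ').symm
    | add S T hS hT h1 h2 =>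
      exact (map_add Γ ⟨S, subset_closure hS⟩ ⟨T, subset_closure hT⟩).trans
        ((congrArg₂ (· + ·) h1 h2).trans
          (map_add Γ' ⟨S, subset_closure hS⟩ ⟨T, subset_closure hT⟩).symm)
    | smul c T hT h1 =>
      exact (map_smul Γ c ⟨T, subset_closure hT⟩).trans
        ((congrArg (c • ·) h1).trans (map_smul Γ' c ⟨T, subset_closure hT⟩).symm)
  ext1 T
  obtain ⟨u, hu, hT⟩ := mem_closure_iff_seq_limit.1 T.2
  have hT' : Filter.Tendsto (fun n => (⟨u n, subset_closure (hu n)⟩ : CompactOps A X))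
      Filter.atTop (nhds T) := tendsto_subtype_rng.2 hT
  have h1 : Filter.Tendsto (fun n => Γ ⟨u n, subset_closure (hu n)⟩) Filter.atTop (nhds (Γ T)) :=
    ((hc Γ).tendsto T).comp hT'
  have h2 : Filter.Tendsto (fun n => Γ' ⟨u n, subset_closure (hu n)⟩) Filter.atTop
      (nhds (Γ' T)) := ((hc Γ').tendsto T).comp hT'
  have h3 : (fun n => Γ ⟨u n, subset_closure (hu n)⟩)
      = fun n => Γ' ⟨u n, subset_closure (hu n)⟩ := funext fun n => hspan (u n) (hu n)
  rw [h3] at h1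
  exact tendsto_nhds_unique h1 h2

namespace IsMinimalStinespring

variable {φ : A → (H →L[ℂ] H)} {Φ : X → (H →L[ℂ] K)}
  {P : X → (H' →L[ℂ] K')} {π : A →⋆ₙₐ[ℂ] (H' →L[ℂ] H')} {W : K →L[ℂ] K'} {V : H →L[ℂ] H'}

theorem isTotalFamily_comp (h : IsMinimalStinespring φ Φ P π W V) :
    IsTotalFamily fun x => P x ∘L V :=
  h.minimal_map

theorem isTotalFamily (h : IsMinimalStinespring φ Φ P π W V) : IsTotalFamily P :=
  h.isTotalFamily_comp.of_comp

theorem comp_eq (h : IsMinimalStinespring φ Φ P π W V) (x : X) : W ∘L Φ x = P x ∘L V := by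
  rw [h.dilation_map, ← ContinuousLinearMap.comp_assoc, h.coisometry,
    ContinuousLinearMap.id_comp]

theorem apply_eq_zero (h : IsMinimalStinespring φ Φ P π W V) {k : K}
    (hk : ∀ x, ((Φ x)†) k = 0) : W k = 0 := by
  refine isTotalFamily_iff.1 h.isTotalFamily_comp _ fun x => ?_
  rw [← hk x, h.dilation_map, ContinuousLinearMap.adjoint_comp (W†),
    ContinuousLinearMap.adjoint_adjoint]
  rfl

/-- The compression of a representation on `K'` by the coisometry `W`. -/
theorem exists_compression (h : IsMinimalStinespring φ Φ P π W V)
    (Γ : CompactOps A X →⋆ₙₐ[ℂ] (K' →L[ℂ] K')) :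
    ∃ ρ : CompactOps A X →⋆ₙₐ[ℂ] (K →L[ℂ] K), ∀ T, ρ T = W† ∘L Γ T ∘L W := by
  refine ⟨{ toFun := fun T => W† ∘L Γ T ∘L W, map_smul' := fun c T => ?_, map_zero' := ?_,
            map_add' := fun S T => ?_, map_mul' := fun S T => ?_, map_star' := fun T => ?_ },
    fun _ => rfl⟩
  · ext; simp
  · ext; simp
  · ext; simp
  · ext k
    have (k' : K') : W ((W†) k') = k' := DFunLike.congr_fun h.coisometry k'
    simp [this]
  · rw [ContinuousLinearMap.star_eq_adjoint, ContinuousLinearMap.adjoint_comp,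
      ContinuousLinearMap.adjoint_comp, ContinuousLinearMap.adjoint_adjoint, map_star]
    rfl

/-- The compression of the induced representation does not depend on the minimal Stinespring
representation: it maps `Φ x ξ` to `Φ (T x) ξ`, and vanishes on the orthogonal complement of these
vectors. -/
theorem compression_eq {H'' K'' : Type*}
    [NormedAddCommGroup H''] [InnerProductSpace ℂ H''] [CompleteSpace H'']
    [NormedAddCommGroup K''] [InnerProductSpace ℂ K''] [CompleteSpace K'']
    {P' : X → (H'' →L[ℂ] K'')} {π' : A →⋆ₙₐ[ℂ] (H'' →L[ℂ] H'')}
    {W' : K →L[ℂ] K''} {V' : H →L[ℂ] H''}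
    (h : IsMinimalStinespring φ Φ P π W V) (h' : IsMinimalStinespring φ Φ P' π' W' V')
    {Γ : CompactOps A X →⋆ₙₐ[ℂ] (K' →L[ℂ] K')} {Γ' : CompactOps A X →⋆ₙₐ[ℂ] (K'' →L[ℂ] K'')}
    (hΓ : ∀ (T : CompactOps A X) x, Γ T ∘L P x = P (T.1.toCLM x))
    (hΓ' : ∀ (T : CompactOps A X) x, Γ' T ∘L P' x = P' (T.1.toCLM x)) (T : CompactOps A X) :
    W† ∘L Γ T ∘L W = W'† ∘L Γ' T ∘L W' := by
  refine ContinuousLinearMap.eq_of_comp_eq_of_orthogonal (Φ := Φ) (fun x => ?_) fun k hk => ?_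
  · rw [ContinuousLinearMap.comp_assoc, ContinuousLinearMap.comp_assoc,
      ContinuousLinearMap.comp_assoc, ContinuousLinearMap.comp_assoc, h.comp_eq, h'.comp_eq,
      ← ContinuousLinearMap.comp_assoc (Γ T), ← ContinuousLinearMap.comp_assoc (Γ' T), hΓ, hΓ',
      ← h.dilation_map, ← h'.dilation_map]
  · simp only [ContinuousLinearMap.comp_apply, h.apply_eq_zero hk, h'.apply_eq_zero hk, map_zero]

theorem blockMap_eq (h : IsMinimalStinespring φ Φ P π W V)
    {Γ : CompactOps A X → (K' →L[ℂ] K')} {ρ : CompactOps A X → (K →L[ℂ] K)}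
    (hρ : ∀ T, ρ T = W† ∘L Γ T ∘L W) (M : Linking A X) :
    blockMap ρ Φ φ M = blockOp (W†) 0 0 (V†) ∘L blockMap Γ P π M ∘L blockOp W 0 0 V := by
  simp only [blockMap, blockOp_comp, ContinuousLinearMap.comp_zero, ContinuousLinearMap.zero_comp,
    add_zero, zero_add]
  rw [hρ, h.dilation, h.dilation_map, h.dilation_map M.left, ContinuousLinearMap.adjoint_comp,
    ContinuousLinearMap.adjoint_comp, ContinuousLinearMap.adjoint_adjoint]
  rfl

end IsMinimalStinespring

end Linking

/-! ### The induced representation -/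

theorem mainTheorem9 {A X H K : Type u}
    [NonUnitalCStarAlgebra A] [PartialOrder A] [StarOrderedRing A]
    [NormedAddCommGroup X] [NormedSpace ℂ X] [CompleteSpace X] [SMul Aᵐᵒᵖ X] [HilbertModule A X]
    [NormedAddCommGroup H] [InnerProductSpace ℂ H] [CompleteSpace H]
    [NormedAddCommGroup K] [InnerProductSpace ℂ K] [CompleteSpace K]
    (φ : A →CP (H →L[ℂ] H)) (Φ : X → (H →L[ℂ] K)) (hΦ : IsPhiMap φ Φ) :
    (∃! ρ : CompactOps A X →⋆ₙₐ[ℂ] (K →L[ℂ] K), IsInducedRep φ Φ ρ) ∧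
      ((∀ a : A, ‖φ a‖ ≤ ‖a‖) →
        ∀ ρ : CompactOps A X →⋆ₙₐ[ℂ] (K →L[ℂ] K), IsInducedRep φ Φ ρ →
          ∀ M : Linking A X, ‖blockMap ρ Φ φ M‖ ≤ ‖M‖) := by
  obtain ⟨H', _, _, _, K', _, _, _, P, π, W, V, h, hV⟩ := exists_isMinimalStinespring φ Φ hΦ
  obtain ⟨Γ, hθ, hΓ⟩ := h.isPhiMap.exists_rep h.isTotalFamily
  obtain ⟨Θ, hΘ⟩ := h.isPhiMap.exists_linking_rep hθ hΓ
  obtain ⟨ρ, hρ⟩ := h.exists_compression Γ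
  have hD : (blockOp W 0 0 V)† = blockOp (W†) 0 0 (V†) := by
    rw [adjoint_blockOp, map_zero, map_zero]
  have hblock (M : Linking A X) :
      blockMap ρ Φ φ M = (blockOp W 0 0 V)† ∘L Θ M ∘L blockOp W 0 0 V := by
    rw [h.blockMap_eq hρ, hΘ, hD]
  have hind : IsInducedRep φ Φ ρ := by
    refine ⟨?_, fun H'' K'' _ _ _ _ _ _ P' π' W' V' h' => ?_⟩
    · rw [show blockMap ρ Φ φ = _ from funext hblock]
      exact isCompletelyPositive_compression Θ _
    · obtain ⟨Γ', hθ', hΓ'⟩ := h'.isPhiMap.exists_rep h'.isTotalFamily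
      exact ⟨Γ', hθ', h'.blockMap_eq fun T => (hρ T).trans (h.compression_eq h' hΓ hΓ' T)⟩
  have huniq (ρ' : CompactOps A X →⋆ₙₐ[ℂ] (K →L[ℂ] K)) (h' : IsInducedRep φ Φ ρ') : ρ' = ρ := by
    obtain ⟨Γ', hθ', hM⟩ := h'.factorization H' K' P π W V h
    have hΓΓ' : Γ' = Γ := CompactOps.rep_ext fun x y => by rw [hθ', hθ]
    ext1 T
    -- the upper left corners of the factorizations of `[[T, 0], [0, 0]]`
    have hT := hM ⟨T, 0, 0, 0⟩
    rw [hΓΓ', ← h.blockMap_eq hρ] at hT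
    ext k
    have := congrArg (fun S => (S (WithLp.toLp 2 (k, (0 : H)))).fst) hT
    simp only [blockMap, blockOp_apply, map_zero, add_zero] at this
    exact this
  refine ⟨⟨ρ, hind, huniq⟩, fun hφ ρ' h' M => ?_⟩
  have hW : ‖W‖ ≤ 1 := by
    have h1 : ‖W†‖ * ‖W†‖ ≤ 1 := by
      rw [← ContinuousLinearMap.norm_adjoint_comp_self, ContinuousLinearMap.adjoint_adjoint,
        h.coisometry]
      exact ContinuousLinearMap.norm_id_le
    rw [LinearIsometryEquiv.norm_map] at h1
    nlinarith [norm_nonneg W]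
  have hD1 : ‖blockOp W 0 0 V‖ ≤ 1 := norm_blockOp_diag_le hW (hV hφ)
  rw [huniq ρ' h', hblock]
  calc _ ≤ ‖(blockOp W 0 0 V)†‖ * (‖Θ M‖ * ‖blockOp W 0 0 V‖) :=
        (ContinuousLinearMap.opNorm_comp_le _ _).trans
          (by gcongr; exact ContinuousLinearMap.opNorm_comp_le _ _)
    _ ≤ 1 * (‖M‖ * 1) := by
        rw [LinearIsometryEquiv.norm_map]
        gcongr
        exact NonUnitalStarAlgHom.norm_apply_le Θ M
    _ = ‖M‖ := by ring
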